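/- **Definitions.** A continuum is a nonempty compact connected subset of $\mathbb C=\mathbb R^2$. Let $X\subset\mathbb C$ be a continuum. A point $x\in\partial X$ is separated from $y\in\partial X$ by a set $C$ if $\partial X\setminus C=A\cup B$ with $x\in A$, $y\in B$ and $\overline A\cap B=A\cap\overline B=\emptyset$. For $x\in\partial X$ let $E_x^*$ be the set of all $y\in\partial X$ that are not separated from $x$ by any finite set $C\subset\partial X$; for $x$ in the interior of $X$ let $E_x^*=\{x\}$. The fiber $F_x^*$ of $X$ at $x$ is the connected component of $E_x^*$ containing $x$. The local scale $\ell^*(X,x)$ is the least integer $p\ge 0$ for which there are $k\le p+1$ and continua $X=N_0\supset N_1\supset\cdots\supset N_k=\{x\}$ such that $N_i$ is a fiber of $N_{i-1}$ for $1\le i\le k$ (and $\infty$ if there is no such $p$), and $\ell^*(X)=\sup_{x\in X}\ell^*(X,x)$. Let $X_0$ be the union of all fibers $F^*_x$ with $F_x^*\neq\{x\}$; write $x\sim y$ if $x=y$ or if $x,y$ lie in the same connected component of $\overline{X_0}$, and give $X/\!\sim$ the quotient topology. Let $\mathcal K\subset[0,1]$ be Cantor's ternary set and $\mathcal K+1=\{t+1:t\in\mathcal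 K\}$. Put $$X_1=\bigl((\mathcal K+1)\times[0,2]\bigr)\cup\bigl([1,2]\times\{2\}\bigr),\qquad X_2=X_1\cup\bigl([0,1]\times(\mathcal K+1)\bigr),$$ $$X_{k+2}=X_2\cup\tfrac12X_k\quad(k\ge1),\qquad X_\infty=\{(0,0)\}\cup\bigcup_{k\ge2}X_k.$$ **Statement.** 1. For every $k\ge1$, $X_k$ is a path-connected continuum, $\ell^*(X_k)=k$, and $X_k/\!\sim$ is homeomorphic to $[0,1]$. 2. $X_\infty$ is a path-connected continuum, $\ell^*(X_\infty)=\infty$, and $X_\infty/\!\sim$ is homeomorphic to $[0,1]$. 3. $X_1$ is homeomorphic to Cantor's comb $(\mathcal K\times[0,1])\cup([0,1]\times\{1\})$. The fiber of $X_1$ at $z=(z_1,z_2)\in X_1$ is $\{z_1\}\times[0,2]$ if $z_1\in\mathcal K+1$, and $\{z\}$ otherwise. 4. Let $Y=X_k$ with $k\ge2$, or $Y=X_\infty$, and let $L(Y)=Y\cap\{(x_1,x_2):x_1\le1\}$. Then $(1,2)\in Y$ and $L(Y)$ is the fiber of $Y$ at $(1,2)$, and at every other point of $L(Y)$. The fiber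 of $Y$ at $z=(z_1,z_2)\in Y$ with $z_1>1$ is $\{z_1\}\times[0,2]$ if $z_1\in\mathcal K+1$, and $\{z\}$ otherwise; its scale is strictly smaller than $\ell^*(L(Y))$. 5. For every $k\ge1$, $L(X_{k+2})$ is homeomorphic to $X_{k+1}$; moreover $L(X_\infty)$ is homeomorphic to $X_\infty$. -/

import Mathlib

noncomputable section

namespace CombFiber

open Set

/-! ## Fibers and the scale of non-local connectedness of planar continua -/

/-- A continuum in the plane: a nonempty compact connected set. -/
def IsContinuum (X : Set ℂ) : Prop := IsCompact X ∧ IsConnected X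

/-- `x` is separated from `y` by `C`: there is a separation `∂X ∖ C = A ∪ B` with `x ∈ A` and
`y ∈ B`. -/
def SeparatedBy (X C : Set ℂ) (x y : ℂ) : Prop :=
  ∃ A B : Set ℂ, frontier X \ C = A ∪ B ∧ closure A ∩ B = ∅ ∧ A ∩ closure B = ∅ ∧ x ∈ A ∧ y ∈ B

/-- The modified pseudo-fiber `E*_x` of `X` at `x`: it is `{x}` when `x` is an interior point, and
for a boundary point `x` it is the set of boundary points which no finite subset of the boundary
separates from `x`. -/
def pseudoFiber (X : Set ℂ) (x : ℂ) : Set ℂ :=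
  {y | (x ∈ interior X ∧ y = x) ∨
    (x ∈ frontier X ∧ y ∈ frontier X ∧
      ∀ C : Set ℂ, C ⊆ frontier X → C.Finite → ¬ SeparatedBy X C x y)}

/-- The modified fiber `F*_x` of `X` at `x`: the component of `E*_x` that contains `x`. -/
def fiber (X : Set ℂ) (x : ℂ) : Set ℂ := connectedComponentIn (pseudoFiber X x) x

/-- `N` is a fiber of `M` (at some point of `M`). -/
def IsFiberOf (N M : Set ℂ) : Prop := ∃ y ∈ M, N = fiber M y

/-- There are continua `X = N 0 ⊇ N 1 ⊇ ⋯ ⊇ N k = {x}`, each a fiber of the one before it. -/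
def HasFiberChain (X : Set ℂ) (x : ℂ) (k : ℕ) : Prop :=
  ∃ N : ℕ → Set ℂ, N 0 = X ∧ N k = {x} ∧ (∀ i ≤ k, IsContinuum (N i)) ∧
    ∀ i < k, N (i + 1) ⊆ N i ∧ IsFiberOf (N (i + 1)) (N i)

/-- The local scale `ℓ*(X, x)`: the least `p` such that there is a chain of fibers of length
`k ≤ p + 1` from `X` to `{x}`, and `∞` if there is none. -/
def localScale (X : Set ℂ) (x : ℂ) : ℕ∞ :=
  ⨅ (p : ℕ) (_ : ∃ k ≤ p + 1, HasFiberChain X x k), (p : ℕ∞)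

/-- The scale `ℓ*(X)` of non-local connectedness. -/
def nlcScale (X : Set ℂ) : ℕ∞ := ⨆ x ∈ X, localScale X x

/-- The union of all nontrivial fibers of `X`. -/
def nontrivialFibers (X : Set ℂ) : Set ℂ := ⋃ x ∈ {x | x ∈ X ∧ fiber X x ≠ {x}}, fiber X x

/-- The relation `∼` on `X`: `x ∼ y` if `x = y`, or if `x` and `y` lie in the same component of the
closure of the union of all nontrivial fibers. -/
def fiberSetoid (X : Set ℂ) : Setoid X where
  r x y := x = y ∨ ((x : ℂ) ∈ closure (nontrivialFibers X) ∧
    (y : ℂ) ∈ connectedComponentIn (closure (nontrivialFibers X)) x)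
  iseqv := by
    refine ⟨fun x => Or.inl rfl, ?_, ?_⟩
    · rintro x y (h | ⟨hx, hy⟩)
      · exact Or.inl h.symm
      · refine Or.inr ⟨connectedComponentIn_subset _ _ hy, ?_⟩
        rw [← connectedComponentIn_eq hy]
        exact mem_connectedComponentIn hx
    · rintro x y z (rfl | ⟨hx, hy⟩) (rfl | ⟨hy', hz⟩)
      · exact Or.inl rfl
      · exact Or.inr ⟨hy', hz⟩
      · exact Or.inr ⟨hx, hy⟩
      · refine Or.inr ⟨hx, ?_⟩
        rw [connectedComponentIn_eq hy]
        exact hz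

/-- The quotient space `X/∼`, with the quotient topology. -/
abbrev FiberQuotient (X : Set ℂ) : Type := Quotient (fiberSetoid X)

/-! ## The combs; a point `(x₁, x₂)` of the plane is the complex number `x₁ + i x₂` -/

/-- The translate `K + 1` of the ternary Cantor set `K ⊆ [0, 1]`. -/
def shiftedCantor : Set ℝ := (fun t => t + 1) '' cantorSet

/-- Cantor's comb `K × [0, 1] ∪ [0, 1] × {1}`. -/
def cantorComb : Set ℂ :=
  {z | z.re ∈ cantorSet ∧ z.im ∈ Icc 0 1} ∪ {z | z.re ∈ Icc 0 1 ∧ z.im = 1}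

/-- `X₁ = (K + 1) × [0, 2] ∪ [1, 2] × {2}`. -/
def combOne : Set ℂ :=
  {z | z.re ∈ shiftedCantor ∧ z.im ∈ Icc 0 2} ∪ {z | z.re ∈ Icc 1 2 ∧ z.im = 2}

/-- `X₂ = X₁ ∪ [0, 1] × (K + 1)`. -/
def combTwo : Set ℂ := combOne ∪ {z | z.re ∈ Icc 0 1 ∧ z.im ∈ shiftedCantor}

/-- The sequence `X_k`, `k ≥ 1`, with `X_{k+2} = X₂ ∪ ½ X_k`. The index `0` is not part of the
sequence and carries the empty set. -/
def comb : ℕ → Set ℂ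
  | 0 => ∅
  | 1 => combOne
  | 2 => combTwo
  | k + 3 => combTwo ∪ (fun z => z / 2) '' comb (k + 1)

/-- `X_∞ = {(0, 0)} ∪ ⋃_{k ≥ 2} X_k`. -/
def combInfty : Set ℂ := {0} ∪ ⋃ k ≥ 2, comb k

/-- The part `X ∩ {(x₁, x₂) : x₁ ≤ 1}` of `X`. -/
def leftPart (X : Set ℂ) : Set ℂ := X ∩ {z | z.re ≤ 1}

end CombFiber

end

namespace CombFiber

open Set Topology Filter

/-! ## Separations -/

/-! Let h be the map (x, y) ↦ (y/2, x), written `halfSwap`. Its square is halving, and X₂ = X₁ ∪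
h(X₁), so the two-step recursion becomes X_{k+1} = X₁ ∪ h(X_k) (`comb_succ_succ`), with X_∞ = X₁ ∪
h(X_∞) as its fixed point (`combInfty_eq`). Everything is proved for Y = X₁ ∪ h(Z), where Z is an
abstract `CombLike` set.

The fibers of Y are the level sets of max(Re, 1). At a level t > 1 outside the Cantor set, Y has the
single point (t, 2). Such levels are dense above 1, so finite sets separate different level sets.
Conversely, a finite set C cannot cut a level set. The Cantor set is perfect, so each tooth is a
limit of teeth that miss C, and each of those lies on one side of a separation
(`not_mem_tooth_of_separation`). In the left part this argument passes from tooth 1, the common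
piece of X₁ and h(Z ∪ topBar), to all of h(Z) through the field `diff_subset`. `SliceFibers`
packages the outcome: the fibers partition Y, and the level function identifies the quotient with an
interval.

Because the fibers partition Y, a fiber chain ending at x must begin with the fiber at x, so chain
lengths obey a recursion (`SliceFibers.hasFiberChain_succ`). The left part of Y is h(Z ∪ topBar),
and h is a homeomorphism of the plane. Hence each step of the recursion raises the scale by exactly
one (`CombLike.hasScale_succ`). For X_∞ the fiber at 0 is a copy of X_∞ with 0 fixed, so no finite
chain reaches 0. -/

theorem subset_left_of_isPreconnected {A B T : Set ℂ} (hAB : closure A ∩ B = ∅)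
    (hBA : A ∩ closure B = ∅) (hT : IsPreconnected T) (hTs : T ⊆ A ∪ B) {p : ℂ} (hp : p ∈ T)
    (hpA : p ∈ A) : T ⊆ A := by
  have hA : ∀ x ∈ A, x ∉ closure B := fun x h h' =>
    eq_empty_iff_forall_notMem.1 hBA x ⟨h, h'⟩
  have hB : ∀ x ∈ B, x ∉ closure A := fun x h h' =>
    eq_empty_iff_forall_notMem.1 hAB x ⟨h', h⟩
  have hdisj : T ∩ ((closure B)ᶜ ∩ (closure A)ᶜ) = ∅ := by
    refine eq_empty_of_forall_notMem ?_
    rintro x ⟨hx, hxB, hxA⟩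
    exact (hTs hx).elim (fun h => hxA (subset_closure h)) fun h => hxB (subset_closure h)
  rcases isPreconnected_iff_subset_of_disjoint.1 hT (closure B)ᶜ (closure A)ᶜ
    isClosed_closure.isOpen_compl isClosed_closure.isOpen_compl
    (fun x hx => (hTs hx).imp (hA x) (hB x)) hdisj with h | h
  · exact fun x hx => (hTs hx).resolve_right fun hxB => h hx (subset_closure hxB)
  · exact absurd (subset_closure hpA) (h hp)

/-- A point of the plane lying in a separated pair belongs to the part it adheres to. -/
theorem mem_left_of_mem_closure {A B : Set ℂ} (hAB : closure A ∩ B = ∅) {p : ℂ} (hp : p ∈ A ∪ B)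
    (hpA : p ∈ closure A) : p ∈ A :=
  hp.resolve_right fun hB => eq_empty_iff_forall_notMem.1 hAB p ⟨hpA, hB⟩

theorem SeparatedBy.symm {X C : Set ℂ} {x y : ℂ} (h : SeparatedBy X C x y) :
    SeparatedBy X C y x := by
  obtain ⟨A, B, h₁, h₂, h₃, hx, hy⟩ := h
  exact ⟨B, A, by rw [h₁, union_comm], by rw [inter_comm, h₃], by rw [inter_comm, h₂], hy, hx⟩

theorem not_separatedBy_self (X C : Set ℂ) (x : ℂ) : ¬ SeparatedBy X C x x := by
  rintro ⟨A, B, -, h, -, hx, hy⟩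
  exact eq_empty_iff_forall_notMem.1 h x ⟨subset_closure hx, hy⟩

/-! ## Continua whose fibers are the level sets of a function -/

/-- `Z` is a continuum without interior points whose level sets under `g` are connected and cannot
be separated by finite sets, while finite level sets are dense among all level sets. -/
structure SliceFibers (Z : Set ℂ) (g : ℂ → ℝ) : Prop where
  isContinuum : IsContinuum Z
  interior_eq : interior Z = ∅
  continuous : Continuous g
  exists_finite : ∀ a b : ℝ, a < b → ∃ s ∈ Ioo a b, {w ∈ Z | g w = s}.Finite
  isPreconnected : ∀ z ∈ Z, IsPreconnected {w ∈ Z | g w = g z}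
  not_separatedBy : ∀ C : Set ℂ, C.Finite → ∀ z ∈ Z, ∀ w ∈ Z, g z = g w → ¬ SeparatedBy Z C z w

namespace SliceFibers

variable {Z : Set ℂ} {g : ℂ → ℝ}

theorem frontier_eq (h : SliceFibers Z g) : frontier Z = Z := by
  rw [h.isContinuum.1.isClosed.frontier_eq, h.interior_eq, sdiff_empty]

/-- Deleting a finite level set strictly between the two values leaves a strict sublevel set and a
strict superlevel set, which are separated by continuity of `g`. -/
theorem exists_separatedBy (h : SliceFibers Z g) {z w : ℂ} (hz : z ∈ Z) (hw : w ∈ Z)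
    (hzw : g z < g w) : ∃ C ⊆ Z, C.Finite ∧ SeparatedBy Z C z w := by
  obtain ⟨s, ⟨hs₁, hs₂⟩, hs⟩ := h.exists_finite _ _ hzw
  refine ⟨{w ∈ Z | g w = s}, fun x hx => hx.1, hs,
    {x ∈ Z | g x < s}, {x ∈ Z | s < g x}, ?_, ?_, ?_, ⟨hz, hs₁⟩, ⟨hw, hs₂⟩⟩
  · rw [h.frontier_eq]
    ext x
    simp only [Set.mem_sdiff, mem_ofPred_eq, mem_union, not_and]
    constructor
    · rintro ⟨hx, hne⟩
      exact (lt_or_gt_of_ne (hne hx)).imp (fun h => ⟨hx, h⟩) fun h => ⟨hx, h⟩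
    · rintro (⟨hx, h⟩ | ⟨hx, h⟩)
      · exact ⟨hx, fun _ => h.ne⟩
      · exact ⟨hx, fun _ => h.ne'⟩
  · refine eq_empty_of_forall_notMem ?_
    rintro x ⟨hx, -, hxs⟩
    have : x ∈ {x | g x ≤ s} := closure_minimal (fun y hy => hy.2.le)
      (isClosed_le h.continuous continuous_const) hx
    exact absurd hxs (not_lt.2 this)
  · refine eq_empty_of_forall_notMem ?_
    rintro x ⟨⟨-, hxs⟩, hx⟩
    have : x ∈ {x | s ≤ g x} := closure_minimal (fun y hy => hy.2.le)
      (isClosed_le continuous_const h.continuous) hx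
    exact absurd hxs (not_lt.2 this)

theorem pseudoFiber_eq (h : SliceFibers Z g) {z : ℂ} (hz : z ∈ Z) :
    pseudoFiber Z z = {w ∈ Z | g w = g z} := by
  ext w
  simp only [pseudoFiber, h.interior_eq, mem_empty_iff_false, false_and, false_or,
    h.frontier_eq, mem_ofPred_eq, hz, true_and]
  refine and_congr_right fun hw => ⟨fun hsep => ?_, fun hg C _ hC =>
    h.not_separatedBy C hC z hz w hw hg.symm⟩
  by_contra hne
  rcases lt_or_gt_of_ne hne with hlt | hlt
  · obtain ⟨C, hCZ, hC, hs⟩ := h.exists_separatedBy hw hz hlt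
    exact hsep C hCZ hC hs.symm
  · obtain ⟨C, hCZ, hC, hs⟩ := h.exists_separatedBy hz hw hlt
    exact hsep C hCZ hC hs

/-- The fibers are the level sets. -/
theorem fiber_eq (h : SliceFibers Z g) {z : ℂ} (hz : z ∈ Z) :
    fiber Z z = {w ∈ Z | g w = g z} := by
  rw [fiber, h.pseudoFiber_eq hz]
  exact (h.isPreconnected z hz).connectedComponentIn ⟨hz, rfl⟩

theorem mem_fiber (h : SliceFibers Z g) {z : ℂ} (hz : z ∈ Z) : z ∈ fiber Z z := by
  rw [h.fiber_eq hz]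
  exact ⟨hz, rfl⟩

theorem fiber_subset (h : SliceFibers Z g) {z : ℂ} (hz : z ∈ Z) : fiber Z z ⊆ Z := by
  rw [h.fiber_eq hz]
  exact fun w hw => hw.1

theorem fiber_eq_of_mem (h : SliceFibers Z g) {y z : ℂ} (hy : y ∈ Z) (hz : z ∈ fiber Z y) :
    fiber Z y = fiber Z z := by
  rw [h.fiber_eq hy] at hz ⊢
  rw [h.fiber_eq hz.1, hz.2]

/-- The union of the nontrivial fibers, when these are the level sets over `K`. -/
theorem nontrivialFibers_eq (h : SliceFibers Z g) {K : Set ℝ}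
    (hK : ∀ z ∈ Z, {w ∈ Z | g w = g z} = {z} ↔ g z ∉ K) :
    nontrivialFibers Z = {w ∈ Z | g w ∈ K} := by
  ext w
  simp only [nontrivialFibers, mem_ofPred_eq, mem_iUnion, exists_prop]
  constructor
  · rintro ⟨z, ⟨hz, hne⟩, hw⟩
    rw [h.fiber_eq hz] at hne hw
    refine ⟨hw.1, ?_⟩
    rw [hw.2]
    by_contra hcon
    exact hne ((hK z hz).2 hcon)
  · rintro ⟨hw, hwK⟩
    refine ⟨w, ⟨hw, fun heq => ?_⟩, h.mem_fiber hw⟩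
    rw [h.fiber_eq hw] at heq
    exact (hK w hw).1 heq hwK

/-- The nontrivial fibers fill the part of `Z` over `K`, which is already closed. A component of it
has connected image in the totally disconnected `K`, hence lies in one level set; level sets are
themselves connected. -/
theorem fiberSetoid_iff (h : SliceFibers Z g) {K : Set ℝ} (hKc : IsClosed K)
    (hKd : IsTotallyDisconnected K)
    (hK : ∀ z ∈ Z, {w ∈ Z | g w = g z} = {z} ↔ g z ∉ K) (x y : Z) :
    fiberSetoid Z x y ↔ g x = g y := by
  have hcl : closure (nontrivialFibers Z) = {w ∈ Z | g w ∈ K} := by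
    rw [h.nontrivialFibers_eq hK]
    exact (h.isContinuum.1.isClosed.inter (hKc.preimage h.continuous)).closure_eq
  change (x = y ∨ ((x : ℂ) ∈ closure (nontrivialFibers Z) ∧
    (y : ℂ) ∈ connectedComponentIn (closure (nontrivialFibers Z)) x)) ↔ _
  rw [hcl]
  constructor
  · rintro (rfl | ⟨hx, hy⟩)
    · rfl
    · have hsub : g '' connectedComponentIn {w ∈ Z | g w ∈ K} x ⊆ K := by
        rintro _ ⟨w, hw, rfl⟩
        exact (connectedComponentIn_subset _ _ hw).2
      exact hKd _ hsub
        (isPreconnected_connectedComponentIn.image g h.continuous.continuousOn)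
        (mem_image_of_mem g (mem_connectedComponentIn hx))
        (mem_image_of_mem g hy)
  · intro hg
    by_cases hx : g x ∈ K
    · refine Or.inr ⟨⟨x.2, hx⟩, ?_⟩
      have hsub : {w ∈ Z | g w = g x} ⊆ {w ∈ Z | g w ∈ K} :=
        fun w hw => ⟨hw.1, by rw [hw.2]; exact hx⟩
      have hxs : (x : ℂ) ∈ {w ∈ Z | g w = g x} := ⟨x.2, rfl⟩
      have hys : (y : ℂ) ∈ {w ∈ Z | g w = g x} := ⟨y.2, hg.symm⟩
      exact (h.isPreconnected x x.2).subset_connectedComponentIn hxs hsub hys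
    · have hy : (y : ℂ) ∈ {w ∈ Z | g w = g x} := ⟨y.2, hg.symm⟩
      rw [(hK x x.2).2 hx] at hy
      exact Or.inl (Subtype.ext hy.symm)

/-- A continuous surjection from a compact space onto a Hausdorff space is a quotient map, and the
relation is the kernel of `g` on `Z`. -/
theorem nonempty_fiberQuotient_homeomorph (h : SliceFibers Z g) {K : Set ℝ} (hKc : IsClosed K)
    (hKd : IsTotallyDisconnected K)
    (hK : ∀ z ∈ Z, {w ∈ Z | g w = g z} = {z} ↔ g z ∉ K) {a b : ℝ} (hab : a < b)
    (himage : g '' Z = Icc a b) : Nonempty (FiberQuotient Z ≃ₜ unitInterval) := by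
  have : CompactSpace Z := isCompact_iff_compactSpace.1 h.isContinuum.1
  let f : Z → Icc a b := fun z => ⟨g z, himage ▸ mem_image_of_mem g z.2⟩
  have hf : Continuous f := (h.continuous.comp continuous_subtype_val).subtype_mk _
  have hsurj : Function.Surjective f := by
    rintro ⟨t, ht⟩
    rw [← himage] at ht
    obtain ⟨z, hz, rfl⟩ := ht
    exact ⟨⟨z, hz⟩, rfl⟩
  have hquot : IsQuotientMap f := hf.isClosedMap.isQuotientMap hf hsurj
  have hker : fiberSetoid Z = Setoid.ker f := by
    ext x y
    rw [h.fiberSetoid_iff hKc hKd hK]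
    exact Subtype.mk_eq_mk.symm
  change Nonempty (Quotient (fiberSetoid Z) ≃ₜ unitInterval)
  rw [hker]
  exact ⟨(hquot.homeomorph (f := ⟨f, hf⟩)).trans (iccHomeoI a b hab)⟩

end SliceFibers

/-! ## Chains of fibers -/

theorem hasFiberChain_zero {X : Set ℂ} {x : ℂ} : HasFiberChain X x 0 ↔ X = {x} := by
  constructor
  · rintro ⟨N, h₀, h₁, -⟩
    exact h₀.symm.trans h₁
  · rintro rfl
    exact ⟨fun _ => {x}, rfl, rfl, fun i _ => ⟨isCompact_singleton, isConnected_singleton⟩,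
      fun i hi => absurd hi (Nat.not_lt_zero i)⟩

theorem HasFiberChain.mem {X : Set ℂ} {x : ℂ} {k : ℕ} (h : HasFiberChain X x k) : x ∈ X := by
  obtain ⟨N, h₀, h₁, -, h₃⟩ := h
  -- Induction from the end `{x}` of the chain up to `X`.
  have : ∀ i ≤ k, x ∈ N (k - i) := by
    intro i
    induction i with
    | zero => intro _; rw [Nat.sub_zero, h₁]; rfl
    | succ i ih =>
      intro hi
      have := (h₃ (k - (i + 1)) (by omega)).1
      rw [show k - (i + 1) + 1 = k - i by omega] at this
      exact this (ih (by omega))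
  simpa [h₀] using this k le_rfl

/-- The first fiber of a chain may be taken at any point `y`, but it contains `x` because the chain
shrinks to `{x}`. Since fibers are level sets, it equals the fiber at `x`. -/
theorem SliceFibers.hasFiberChain_succ {X : Set ℂ} {g : ℂ → ℝ} (h : SliceFibers X g) {x : ℂ}
    (hx : x ∈ X) (k : ℕ) : HasFiberChain X x (k + 1) ↔ HasFiberChain (fiber X x) x k := by
  constructor
  · rintro ⟨N, h₀, h₁, h₂, h₃⟩
    have hN : HasFiberChain (N 1) x k :=
      ⟨fun i => N (i + 1), rfl, h₁, fun i hi => h₂ _ (by omega), fun i hi => h₃ _ (by omega)⟩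
    obtain ⟨-, y, hy, hNy⟩ := h₃ 0 (by omega)
    rw [h₀] at hy hNy
    simp only [zero_add] at hNy
    rw [hNy] at hN
    rwa [h.fiber_eq_of_mem hy hN.mem] at hN
  · rintro ⟨N, h₀, h₁, h₂, h₃⟩
    refine ⟨fun i => Nat.casesOn i X N, rfl, h₁, ?_, ?_⟩
    · rintro (_ | i) hi
      · exact h.isContinuum
      · exact h₂ i (by omega)
    · rintro (_ | i) hi
      · refine ⟨?_, x, hx, h₀⟩
        change N 0 ⊆ X
        rw [h₀]
        exact h.fiber_subset hx
      · exact h₃ i (by omega)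

theorem localScale_le {X : Set ℂ} {x : ℂ} {k p : ℕ} (hk : k ≤ p + 1) (h : HasFiberChain X x k) :
    localScale X x ≤ p :=
  iInf₂_le p ⟨k, hk, h⟩

theorem le_localScale {X : Set ℂ} {x : ℂ} {n : ℕ} (h : ∀ k ≤ n, ¬ HasFiberChain X x k) :
    (n : ℕ∞) ≤ localScale X x := by
  refine le_iInf₂ fun p hp => ?_
  obtain ⟨k, hk, hc⟩ := hp
  by_contra hlt
  rw [Nat.cast_le] at hlt
  -- If p < n, then k ≤ p + 1 ≤ n.
  exact h k (by omega) hc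

theorem localScale_eq_top {X : Set ℂ} {x : ℂ} (h : ∀ k, ¬ HasFiberChain X x k) :
    localScale X x = ⊤ := by
  refine eq_top_iff.2 (le_iInf₂ fun p hp => ?_)
  obtain ⟨k, -, hc⟩ := hp
  exact absurd hc (h k)

theorem nlcScale_le {X : Set ℂ} {n : ℕ} (h : ∀ x ∈ X, ∃ k ≤ n + 1, HasFiberChain X x k) :
    nlcScale X ≤ n :=
  iSup₂_le fun x hx => by
    obtain ⟨k, hk, hc⟩ := h x hx
    exact localScale_le hk hc

/-- Every point of `X` is reached by a chain of at most `n + 1` fibers, and some point is not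
reached by a chain of at most `n` fibers. -/
def HasScale (X : Set ℂ) (n : ℕ) : Prop :=
  (∀ x ∈ X, ∃ k ≤ n + 1, HasFiberChain X x k) ∧ ∃ x ∈ X, ∀ k ≤ n, ¬ HasFiberChain X x k

theorem HasScale.nlcScale_eq {X : Set ℂ} {n : ℕ} (h : HasScale X n) : nlcScale X = n := by
  apply le_antisymm
  · exact nlcScale_le h.1
  · obtain ⟨x, hx, hc⟩ := h.2
    exact (le_localScale hc).trans (le_iSup₂ (f := fun x (_ : x ∈ X) => localScale X x) x hx)

/-! ## Invariance under homeomorphisms of the plane -/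

theorem IsContinuum.image {X : Set ℂ} (h : IsContinuum X) (e : ℂ ≃ₜ ℂ) : IsContinuum (e '' X) :=
  ⟨h.1.image e.continuous, h.2.image e e.continuous.continuousOn⟩

theorem SeparatedBy.image {X C : Set ℂ} {x y : ℂ} (h : SeparatedBy X C x y) (e : ℂ ≃ₜ ℂ) :
    SeparatedBy (e '' X) (e '' C) (e x) (e y) := by
  obtain ⟨A, B, h₁, h₂, h₃, hx, hy⟩ := h
  refine ⟨e '' A, e '' B, ?_, ?_, ?_, mem_image_of_mem e hx, mem_image_of_mem e hy⟩
  · rw [← e.image_frontier, ← image_sdiff e.injective, h₁, image_union]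
  · rw [← e.image_closure, ← image_inter e.injective, h₂, image_empty]
  · rw [← e.image_closure, ← image_inter e.injective, h₃, image_empty]

theorem image_pseudoFiber_subset (e : ℂ ≃ₜ ℂ) (X : Set ℂ) (x : ℂ) :
    e '' pseudoFiber X x ⊆ pseudoFiber (e '' X) (e x) := by
  rintro _ ⟨y, hy, rfl⟩
  rcases hy with ⟨hx, rfl⟩ | ⟨hx, hy, hs⟩
  · exact Or.inl ⟨e.image_interior X ▸ mem_image_of_mem e hx, rfl⟩
  · refine Or.inr ⟨e.image_frontier X ▸ mem_image_of_mem e hx,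
      e.image_frontier X ▸ mem_image_of_mem e hy, fun C hCX hC hsep => ?_⟩
    have hC' : e.symm '' C ⊆ frontier X := by
      rintro _ ⟨c, hc, rfl⟩
      have := hCX hc
      rw [← e.image_frontier] at this
      obtain ⟨d, hd, rfl⟩ := this
      simpa using hd
    have := hsep.image e.symm
    simp only [← image_comp, e.symm_comp_self, image_id, e.symm_apply_apply] at this
    exact hs _ hC' (hC.image _) this

theorem image_pseudoFiber (e : ℂ ≃ₜ ℂ) (X : Set ℂ) (x : ℂ) :
    e '' pseudoFiber X x = pseudoFiber (e '' X) (e x) := by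
  refine (image_pseudoFiber_subset e X x).antisymm fun y hy => ?_
  have := image_pseudoFiber_subset e.symm _ _ (mem_image_of_mem e.symm hy)
  simp only [← image_comp, e.symm_comp_self, image_id, e.symm_apply_apply] at this
  exact ⟨e.symm y, this, e.apply_symm_apply y⟩

/-- Pseudo-fibers depend on the interior and frontier in the plane; a homeomorphism of the whole
plane preserves both. -/
theorem image_fiber (e : ℂ ≃ₜ ℂ) (X : Set ℂ) (x : ℂ) :
    e '' fiber X x = fiber (e '' X) (e x) := by
  rw [fiber, fiber, ← image_pseudoFiber]
  by_cases hx : x ∈ pseudoFiber X x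
  · exact e.image_connectedComponentIn hx
  -- Off its own pseudo-fiber, `connectedComponentIn` takes its default value `∅` on both sides.
  · rw [connectedComponentIn_eq_empty hx, connectedComponentIn_eq_empty, image_empty]
    rintro ⟨y, hy, hyx⟩
    exact hx (e.injective hyx ▸ hy)

theorem HasFiberChain.image {X : Set ℂ} {x : ℂ} {k : ℕ} (h : HasFiberChain X x k) (e : ℂ ≃ₜ ℂ) :
    HasFiberChain (e '' X) (e x) k := by
  obtain ⟨N, h₀, h₁, h₂, h₃⟩ := h
  refine ⟨fun i => e '' N i, congrArg _ h₀, by simp [h₁], fun i hi => (h₂ i hi).image e,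
    fun i hi => ⟨image_mono (h₃ i hi).1, ?_⟩⟩
  obtain ⟨y, hy, hN⟩ := (h₃ i hi).2
  refine ⟨e y, mem_image_of_mem e hy, ?_⟩
  rw [← image_fiber, ← hN]

theorem hasFiberChain_image {X : Set ℂ} {x : ℂ} {k : ℕ} (e : ℂ ≃ₜ ℂ) :
    HasFiberChain (e '' X) (e x) k ↔ HasFiberChain X x k := by
  refine ⟨fun h => ?_, fun h => h.image e⟩
  have := h.image e.symm
  simpa only [← image_comp, e.symm_comp_self, image_id, e.symm_apply_apply] using this

theorem localScale_image (e : ℂ ≃ₜ ℂ) (X : Set ℂ) (x : ℂ) :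
    localScale (e '' X) (e x) = localScale X x := by
  simp only [localScale, hasFiberChain_image]

theorem nlcScale_image (e : ℂ ≃ₜ ℂ) (X : Set ℂ) : nlcScale (e '' X) = nlcScale X := by
  simp only [nlcScale, iSup_image, localScale_image]

/-! ## The Cantor set -/

theorem one_mem_cantorSet : (1 : ℝ) ∈ cantorSet := by
  refine mem_iInter.2 fun n => ?_
  induction n with
  | zero => simp
  | succ n ih => exact Or.inr ⟨1, ih, by norm_num⟩

theorem isTotallyDisconnected_cantorSet : IsTotallyDisconnected cantorSet :=
  totallyDisconnectedSpace_subtype_iff.1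
    cantorSetHomeomorphNatToBool.symm.totallyDisconnectedSpace

/-- Perfectness by self-similarity: each point lies in one of two thirds-scale copies, and a
neighbour of its preimage is moved three times closer. The start uses the endpoints 0 and 1. -/
theorem exists_mem_cantorSet_near (n : ℕ) :
    ∀ t ∈ cantorSet, ∃ u ∈ cantorSet, u ≠ t ∧ |u - t| ≤ (1 / 3) ^ n := by
  induction n with
  | zero =>
    intro t ht
    have h₁ := cantorSet_subset_unitInterval ht
    by_cases h : t = 0
    · exact ⟨1, one_mem_cantorSet, by simp [h], by simp [h]⟩
    · exact ⟨0, zero_mem_cantorSet, Ne.symm h, by simpa [abs_of_nonneg h₁.1] using h₁.2⟩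
  | succ n ih =>
    intro t ht
    rw [cantorSet_eq_union_halves] at ht
    rcases ht with ⟨a, ha, rfl⟩ | ⟨a, ha, rfl⟩
    · obtain ⟨u, hu, hne, hle⟩ := ih a ha
      refine ⟨u / 3, ?_, fun h => hne (by simpa using h), ?_⟩
      · rw [cantorSet_eq_union_halves]
        exact Or.inl ⟨u, hu, rfl⟩
      · simp only
        rw [← sub_div, abs_div, abs_of_pos (by norm_num : (0 : ℝ) < 3), pow_succ]
        linarith
    · obtain ⟨u, hu, hne, hle⟩ := ih a ha
      refine ⟨(2 + u) / 3, ?_, fun h => hne (by linarith), ?_⟩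
      · rw [cantorSet_eq_union_halves]
        exact Or.inr ⟨u, hu, rfl⟩
      · simp only
        rw [← sub_div, add_sub_add_left_eq_sub, abs_div, abs_of_pos (by norm_num : (0 : ℝ) < 3),
          pow_succ]
        linarith

theorem mem_shiftedCantor {t : ℝ} : t ∈ shiftedCantor ↔ t - 1 ∈ cantorSet :=
  ⟨fun ⟨s, hs, h⟩ => by rw [← h]; simpa using hs, fun h => ⟨t - 1, h, by simp⟩⟩

theorem shiftedCantor_subset : shiftedCantor ⊆ Icc 1 2 := fun t ht => by
  have := cantorSet_subset_unitInterval (mem_shiftedCantor.1 ht)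
  exact ⟨by linarith [this.1], by linarith [this.2]⟩

theorem one_mem_shiftedCantor : (1 : ℝ) ∈ shiftedCantor :=
  mem_shiftedCantor.2 (by simpa using zero_mem_cantorSet)

theorem two_mem_shiftedCantor : (2 : ℝ) ∈ shiftedCantor :=
  mem_shiftedCantor.2 (by norm_num; exact one_mem_cantorSet)

theorem isCompact_shiftedCantor : IsCompact shiftedCantor :=
  isCompact_cantorSet.image (by fun_prop)

theorem isTotallyDisconnected_shiftedCantor : IsTotallyDisconnected shiftedCantor :=
  (Homeomorph.addRight (1 : ℝ)).isEmbedding.isTotallyDisconnected_image.2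
    isTotallyDisconnected_cantorSet

theorem exists_notMem_shiftedCantor {a b : ℝ} (h : a < b) : ∃ s ∈ Ioo a b, s ∉ shiftedCantor := by
  by_contra! hcon
  have hs := isTotallyDisconnected_shiftedCantor _ hcon isPreconnected_Ioo
  have := hs (x := (2 * a + b) / 3) ⟨by linarith, by linarith⟩
    (y := (a + 2 * b) / 3) ⟨by linarith, by linarith⟩
  linarith

theorem interior_shiftedCantor : interior shiftedCantor = ∅ := by
  rw [interior_eq_empty_iff_dense_compl]
  refine dense_of_exists_between fun a b hab => ?_
  obtain ⟨s, hs, hsK⟩ := exists_notMem_shiftedCantor hab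
  exact ⟨s, hsK, hs.1, hs.2⟩

/-- Every point is an accumulation point, so removing finitely many points does not isolate it. This
is why finite sets cannot separate teeth. -/
theorem mem_closure_shiftedCantor_diff {t : ℝ} (ht : t ∈ shiftedCantor) {F : Set ℝ}
    (hF : F.Finite) : t ∈ closure (shiftedCantor \ F) := by
  have hacc : AccPt t (𝓟 shiftedCantor) := by
    rw [accPt_iff_nhds]
    intro U hU
    obtain ⟨ε, hε, hball⟩ := Metric.mem_nhds_iff.1 hU
    obtain ⟨n, hn⟩ := exists_pow_lt_of_lt_one hε (by norm_num : (1 / 3 : ℝ) < 1)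
    obtain ⟨u, hu, hne, hle⟩ := exists_mem_cantorSet_near n _ (mem_shiftedCantor.1 ht)
    refine ⟨u + 1, ⟨hball ?_, u, hu, rfl⟩, fun h => hne (by linarith)⟩
    rw [Metric.mem_ball, Real.dist_eq, show u + 1 - t = u - (t - 1) by ring]
    exact hle.trans_lt hn
  rw [accPt_iff_frequently_nhdsNE] at hacc
  have hev : ∀ᶠ y in 𝓝[≠] t, y ∉ F := by
    -- `t` itself may lie in `F`, so it is taken out first; the punctured neighbourhood excludes it
    -- anyway.
    have : (F \ {t})ᶜ ∈ 𝓝 t :=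
      (hF.subset sdiff_subset).isClosed.isOpen_compl.mem_nhds fun h => h.2 rfl
    filter_upwards [nhdsWithin_le_nhds this, self_mem_nhdsWithin] with y hy hne hyF
    exact hy ⟨hyF, hne⟩
  rw [mem_closure_iff_frequently]
  exact (hacc.and_eventually hev).filter_mono nhdsWithin_le_nhds

/-! ## Teeth, spine and box -/

/-- The vertical segment `{t} × [0, 2]`. -/
def tooth (t : ℝ) : Set ℂ := {w | w.re = t ∧ w.im ∈ Icc 0 2}

/-- The segment `[1, 2] × {2}`. -/
def spine : Set ℂ := {z | z.re ∈ Icc 1 2 ∧ z.im = 2}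

/-- The segment `[0, 2] × {2}`. -/
def topBar : Set ℂ := {z | z.re ∈ Icc 0 2 ∧ z.im = 2}

/-- The square `[0, 2] × [0, 2]`. -/
def box : Set ℂ := {z | z.re ∈ Icc 0 2 ∧ z.im ∈ Icc 0 2}

theorem continuous_complex_mk {f g : ℝ → ℝ} (hf : Continuous f) (hg : Continuous g) :
    Continuous fun t => (⟨f t, g t⟩ : ℂ) :=
  Complex.equivRealProdCLM.symm.continuous.comp (hf.prodMk hg)

theorem convex_reProdIm {s t : Set ℝ} (hs : Convex ℝ s) (ht : Convex ℝ t) :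
    Convex ℝ {z : ℂ | z.re ∈ s ∧ z.im ∈ t} :=
  (hs.linear_preimage Complex.reLm).inter (ht.linear_preimage Complex.imLm)

theorem isCompact_reProdIm {s t : Set ℝ} (hs : IsCompact s) (ht : IsCompact t) :
    IsCompact {z : ℂ | z.re ∈ s ∧ z.im ∈ t} :=
  hs.reProdIm ht

theorem convex_tooth (t : ℝ) : Convex ℝ (tooth t) :=
  convex_reProdIm (convex_singleton t) (convex_Icc 0 2)

theorem convex_spine : Convex ℝ spine := convex_reProdIm (convex_Icc 1 2) (convex_singleton 2)

theorem convex_topBar : Convex ℝ topBar := convex_reProdIm (convex_Icc 0 2) (convex_singleton 2)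

theorem isPreconnected_tooth (t : ℝ) : IsPreconnected (tooth t) := (convex_tooth t).isPreconnected

theorem isCompact_tooth (t : ℝ) : IsCompact (tooth t) :=
  isCompact_reProdIm isCompact_singleton isCompact_Icc

theorem isCompact_topBar : IsCompact topBar :=
  isCompact_reProdIm isCompact_Icc isCompact_singleton

theorem tooth_ne_singleton (t : ℝ) (z : ℂ) : tooth t ≠ {z} := by
  intro h
  have h₁ : (⟨t, 0⟩ : ℂ) ∈ tooth t := ⟨rfl, by norm_num⟩
  have h₂ : (⟨t, 2⟩ : ℂ) ∈ tooth t := ⟨rfl, by norm_num⟩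
  rw [h, mem_singleton_iff] at h₁ h₂
  have := congrArg Complex.im (h₁.trans h₂.symm)
  norm_num at this

theorem combOne_eq : combOne = {z | z.re ∈ shiftedCantor ∧ z.im ∈ Icc 0 2} ∪ spine := rfl

theorem spine_subset_combOne : spine ⊆ combOne := subset_union_right

theorem tooth_subset_combOne {t : ℝ} (ht : t ∈ shiftedCantor) : tooth t ⊆ combOne :=
  fun _ hz => Or.inl ⟨hz.1 ▸ ht, hz.2⟩

theorem combOne_re_mem {z : ℂ} (hz : z ∈ combOne) : z.re ∈ Icc 1 2 :=
  hz.elim (fun h => shiftedCantor_subset h.1) fun h => h.1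

theorem combOne_im_mem {z : ℂ} (hz : z ∈ combOne) : z.im ∈ Icc 0 2 :=
  hz.elim (fun h => h.2) fun h => by rw [h.2]; norm_num

theorem combOne_subset_box : combOne ⊆ box := fun _ hz =>
  ⟨Icc_subset_Icc_left zero_le_one (combOne_re_mem hz), combOne_im_mem hz⟩

theorem topBar_subset_box : topBar ⊆ box := fun z hz => ⟨hz.1, by rw [hz.2]; norm_num⟩

theorem combOne_column {t : ℝ} (ht : t ∈ shiftedCantor) : {w ∈ combOne | w.re = t} = tooth t := by
  ext w
  exact ⟨fun h => ⟨h.2, combOne_im_mem h.1⟩, fun h => ⟨tooth_subset_combOne ht h, h.1⟩⟩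

theorem combOne_im_eq {z : ℂ} (hz : z ∈ combOne) (h : z.re ∉ shiftedCantor) : z.im = 2 :=
  hz.elim (fun h' => absurd h'.1 h) fun h' => h'.2

theorem isCompact_combOne : IsCompact combOne :=
  (isCompact_reProdIm isCompact_shiftedCantor isCompact_Icc).union
    (isCompact_reProdIm isCompact_Icc isCompact_singleton)

theorem interior_topBar : interior topBar = ∅ := by
  change interior (Icc 0 2 ×ℂ {2}) = ∅
  rw [Complex.interior_reProdIm, interior_singleton]
  ext z
  simp [Complex.mem_reProdIm]

theorem interior_combOne : interior combOne = ∅ := by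
  have h : interior spine = ∅ :=
    subset_empty_iff.1 (interior_topBar ▸ interior_mono fun z hz =>
      ⟨Icc_subset_Icc_left zero_le_one hz.1, hz.2⟩)
  rw [combOne_eq, interior_union_isClosed_of_interior_empty
    (isCompact_reProdIm isCompact_shiftedCantor isCompact_Icc).isClosed h]
  change interior (shiftedCantor ×ℂ Icc 0 2) = ∅
  rw [Complex.interior_reProdIm, interior_shiftedCantor]
  ext z
  simp [Complex.mem_reProdIm]

theorem isPathConnected_combOne : IsPathConnected combOne := by
  have h₂ : (⟨2, 2⟩ : ℂ) ∈ spine := ⟨by norm_num, rfl⟩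
  have hspine : ∀ w ∈ spine, JoinedIn combOne ⟨2, 2⟩ w := fun w hw =>
    ((convex_spine.isPathConnected ⟨_, h₂⟩).joinedIn _ h₂ _ hw).mono spine_subset_combOne
  refine ⟨⟨2, 2⟩, spine_subset_combOne h₂, ?_⟩
  rintro w (hw | hw)
  · have hw' : w ∈ tooth w.re := ⟨rfl, hw.2⟩
    have htop : (⟨w.re, 2⟩ : ℂ) ∈ tooth w.re := ⟨rfl, by norm_num⟩
    exact (hspine ⟨w.re, 2⟩ ⟨shiftedCantor_subset hw.1, rfl⟩).trans
      ((((convex_tooth w.re).isPathConnected ⟨_, hw'⟩).joinedIn _ htop _ hw').mono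
        (tooth_subset_combOne hw.1))
  · exact hspine w hw

/-! ## Separations of sets with many teeth -/

section Separation

variable {A B C : Set ℂ}

/-- It suffices that `u` avoids the finitely many real parts of points of `C`. -/
theorem exists_tooth_near {t : ℝ} (ht : t ∈ shiftedCantor) (hC : C.Finite) {O : Set ℝ}
    (hO : IsOpen O) (htO : t ∈ O) : ∃ u ∈ shiftedCantor, u ∈ O ∧ Disjoint (tooth u) C := by
  obtain ⟨u, huO, huK, huC⟩ := mem_closure_iff.1
    (mem_closure_shiftedCantor_diff ht (hC.image Complex.re)) O hO htO
  refine ⟨u, huK, huO, disjoint_left.2 fun w hw hwC => huC ⟨w, hwC, hw.1⟩⟩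

theorem isOpen_setOf_mk_notMem_closure (s : ℝ) (B : Set ℂ) :
    IsOpen {u : ℝ | (⟨u, s⟩ : ℂ) ∉ closure B} :=
  isClosed_closure.isOpen_compl.preimage (continuous_complex_mk continuous_id continuous_const)

/-- No tooth meets both parts of a separation by a finite set. -/
theorem not_mem_tooth_of_separation (hC : C.Finite) (hAB : closure A ∩ B = ∅)
    (hBA : A ∩ closure B = ∅) (hteeth : ∀ t ∈ shiftedCantor, tooth t \ C ⊆ A ∪ B) {t : ℝ}
    (ht : t ∈ shiftedCantor) {p q : ℂ} (hp : p ∈ tooth t) (hq : q ∈ tooth t) (hpA : p ∈ A)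
    (hqB : q ∈ B) : False := by
  have hpB : p ∉ closure B := fun h => eq_empty_iff_forall_notMem.1 hBA p ⟨hpA, h⟩
  have hqA : q ∉ closure A := fun h => eq_empty_iff_forall_notMem.1 hAB q ⟨h, hqB⟩
  -- On a nearby tooth missing `C`, the point at the height of `p` is off `closure B` and the one at
  -- the height of `q` is off `closure A`. That tooth would then meet both parts although it is
  -- connected.
  obtain ⟨u, hu, ⟨hu₁, hu₂⟩, hdisj⟩ := exists_tooth_near ht hC
    ((isOpen_setOf_mk_notMem_closure p.im B).inter (isOpen_setOf_mk_notMem_closure q.im A))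
    ⟨by simpa [← hp.1] using hpB, by simpa [← hq.1] using hqA⟩
  have hsub : tooth u ⊆ A ∪ B := fun w hw => hteeth u hu ⟨hw, disjoint_left.1 hdisj hw⟩
  have h₁ : (⟨u, p.im⟩ : ℂ) ∈ tooth u := ⟨rfl, hp.2⟩
  have h₂ : (⟨u, q.im⟩ : ℂ) ∈ tooth u := ⟨rfl, hq.2⟩
  have hA : (⟨u, p.im⟩ : ℂ) ∈ A := (hsub h₁).resolve_right fun h => hu₁ (subset_closure h)
  exact hu₂ (subset_closure
    (subset_left_of_isPreconnected hAB hBA (isPreconnected_tooth u) hsub h₁ hA h₂))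

/-- If the spine lies in one part of a separation by a finite set, then so do the teeth. -/
theorem combOne_diff_subset (hC : C.Finite) (hAB : closure A ∩ B = ∅)
    (hBA : A ∩ closure B = ∅) (hsub : combOne \ C ⊆ A ∪ B) (hspine : spine \ C ⊆ A) :
    combOne \ C ⊆ A := by
  rintro p ⟨hp | hp, hpC⟩
  · refine mem_left_of_mem_closure hAB (hsub ⟨Or.inl hp, hpC⟩) ?_
    by_contra hcl
    obtain ⟨u, hu, hu₁, hdisj⟩ := exists_tooth_near hp.1 hC
      (isOpen_setOf_mk_notMem_closure p.im A) hcl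
    have htop : (⟨u, 2⟩ : ℂ) ∈ tooth u := ⟨rfl, by norm_num⟩
    have htopA : (⟨u, 2⟩ : ℂ) ∈ A :=
      hspine ⟨⟨shiftedCantor_subset hu, rfl⟩, disjoint_left.1 hdisj htop⟩
    have hmem : (⟨u, p.im⟩ : ℂ) ∈ tooth u := ⟨rfl, hp.2⟩
    exact hu₁ (subset_closure (subset_left_of_isPreconnected hAB hBA (isPreconnected_tooth u)
      (fun w hw => hsub ⟨tooth_subset_combOne hu hw, disjoint_left.1 hdisj hw⟩) htop htopA hmem))
  · exact hspine ⟨hp, hpC⟩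

end Separation

/-! ## The similarity that carries a comb to its left part -/

/-- The map `(x, y) ↦ (y / 2, x)`. -/
noncomputable def halfSwap : ℂ ≃ₜ ℂ where
  toFun z := ⟨z.im / 2, z.re⟩
  invFun z := ⟨z.im, 2 * z.re⟩
  left_inv z := by apply Complex.ext <;> simp; ring
  right_inv z := by apply Complex.ext <;> simp
  continuous_toFun := Complex.equivRealProdCLM.symm.continuous.comp
    ((Complex.continuous_im.div_const 2).prodMk Complex.continuous_re)
  continuous_invFun := Complex.equivRealProdCLM.symm.continuous.comp
    (Complex.continuous_im.prodMk (Complex.continuous_re.const_mul 2))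

theorem halfSwap_apply (z : ℂ) : halfSwap z = ⟨z.im / 2, z.re⟩ := rfl

theorem mem_image_halfSwap {X : Set ℂ} {z : ℂ} :
    z ∈ halfSwap '' X ↔ (⟨z.im, 2 * z.re⟩ : ℂ) ∈ X := by
  rw [halfSwap.image_eq_preimage_symm]
  rfl

theorem halfSwap_halfSwap (z : ℂ) : halfSwap (halfSwap z) = z / 2 := by
  apply Complex.ext <;> simp [halfSwap_apply]

theorem image_halfSwap_image_halfSwap (X : Set ℂ) :
    halfSwap '' (halfSwap '' X) = (fun z => z / 2) '' X := by
  simp only [image_image, halfSwap_halfSwap]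

theorem combTwo_eq : combTwo = combOne ∪ halfSwap '' combOne := by
  ext z
  simp only [combTwo, mem_union, mem_image_halfSwap, combOne, mem_ofPred_eq]
  constructor
  · rintro (h | ⟨⟨h₁, h₂⟩, h₃⟩)
    · exact Or.inl h
    · exact Or.inr (Or.inl ⟨h₃, by linarith, by linarith⟩)
  · rintro (h | ⟨h₁, h₂, h₃⟩ | ⟨h₁, h₂⟩)
    · exact Or.inl h
    · exact Or.inr ⟨⟨by linarith, by linarith⟩, h₁⟩
    -- The image of the spine is {1} × [1, 2], already part of tooth 1.
    · have : z.re = 1 := by linarith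
      exact Or.inl (Or.inl ⟨this ▸ one_mem_shiftedCantor, by linarith [h₁.1], h₁.2⟩)

/-- As `halfSwap` is a square root of halving, the recursion of step two splits into two equal
recursions of step one; all later inductions use this form. -/
theorem comb_succ_succ (k : ℕ) : comb (k + 2) = combOne ∪ halfSwap '' comb (k + 1) := by
  induction k with
  | zero => exact combTwo_eq
  | succ k ih =>
    change combTwo ∪ (fun z => z / 2) '' comb (k + 1) = _
    rw [show k + 1 + 1 = k + 2 from rfl, ih, image_union, combTwo_eq,
      image_halfSwap_image_halfSwap, union_assoc]

theorem tooth_one_subset_image_topBar : tooth 1 ⊆ halfSwap '' topBar := fun z hz =>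
  mem_image_halfSwap.2 ⟨hz.2, by simp [hz.1]⟩

theorem image_topBar : halfSwap '' topBar = tooth 1 := by
  refine Subset.antisymm (fun z hz => ?_) tooth_one_subset_image_topBar
  obtain ⟨h₁, h₂⟩ := mem_image_halfSwap.1 hz
  simp only at h₁ h₂
  exact ⟨by linarith, h₁⟩

theorem image_halfSwap_box {Z : Set ℂ} (hZ : Z ⊆ box) {z : ℂ} (hz : z ∈ halfSwap '' Z) :
    z.re ∈ Icc 0 1 ∧ z.im ∈ Icc 0 2 := by
  obtain ⟨h₁, h₂, h₃⟩ := hZ (mem_image_halfSwap.1 hz)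
  simp only at h₁ h₂ h₃
  exact ⟨⟨by linarith, by linarith⟩, h₁⟩

theorem leftPart_combOne : leftPart combOne = tooth 1 := by
  rw [← combOne_column one_mem_shiftedCantor]
  ext z
  exact ⟨fun h => ⟨h.1, le_antisymm h.2 (combOne_re_mem h.1).1⟩, fun h => ⟨h.1, h.2.le⟩⟩

/-- Cantor's comb contributes only tooth 1 on the left, and this is the image of `topBar`. -/
theorem leftPart_union {Z : Set ℂ} (hZ : Z ⊆ box) :
    leftPart (combOne ∪ halfSwap '' Z) = halfSwap '' (Z ∪ topBar) := by
  rw [image_union, image_topBar, ← leftPart_combOne]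
  ext z
  constructor
  · rintro ⟨h | h, h'⟩
    · exact Or.inr ⟨h, h'⟩
    · exact Or.inl h
  · rintro (h | h)
    · exact ⟨Or.inr h, (image_halfSwap_box hZ h).1.2⟩
    · exact ⟨Or.inl h.1, h.2⟩

/-! ## The common features of the combs -/

/-- A path-connected continuum in the box, without interior points, that contains Cantor's comb, and
in which no finite set separates a point from the whole spine. -/
structure CombLike (Z : Set ℂ) : Prop where
  isCompact : IsCompact Z
  isPathConnected : IsPathConnected Z
  interior_eq : interior Z = ∅
  subset_box : Z ⊆ box
  combOne_subset : combOne ⊆ Z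
  diff_subset : ∀ A B C : Set ℂ, C.Finite → closure A ∩ B = ∅ → A ∩ closure B = ∅ →
    Z \ C ⊆ A ∪ B → spine \ C ⊆ A → Z \ C ⊆ A

theorem combLike_combOne : CombLike combOne where
  isCompact := isCompact_combOne
  isPathConnected := isPathConnected_combOne
  interior_eq := interior_combOne
  subset_box := combOne_subset_box
  combOne_subset := Subset.rfl
  diff_subset _ _ _ hC hAB hBA hsub hspine := combOne_diff_subset hC hAB hBA hsub hspine

namespace CombLike

variable {Z : Set ℂ}

theorem isContinuum (h : CombLike Z) : IsContinuum Z := ⟨h.isCompact, h.isPathConnected.isConnected⟩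

theorem tooth_subset (h : CombLike Z) {t : ℝ} (ht : t ∈ shiftedCantor) : tooth t ⊆ Z :=
  (tooth_subset_combOne ht).trans h.combOne_subset

theorem spine_subset (h : CombLike Z) : spine ⊆ Z := spine_subset_combOne.trans h.combOne_subset

/-- The spine of `Z` is carried into tooth 1, so in the image tooth 1 takes over the role of the
spine. -/
theorem image_diff_subset (h : CombLike Z) {A B C : Set ℂ} (hC : C.Finite)
    (hAB : closure A ∩ B = ∅) (hBA : A ∩ closure B = ∅) (hsub : (halfSwap '' Z) \ C ⊆ A ∪ B)
    (htooth : tooth 1 \ C ⊆ A) : (halfSwap '' Z) \ C ⊆ A := by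
  have hpre := h.diff_subset (halfSwap ⁻¹' A) (halfSwap ⁻¹' B) (halfSwap ⁻¹' C)
    (hC.preimage halfSwap.injective.injOn)
    (by rw [← halfSwap.preimage_closure, ← preimage_inter, hAB, preimage_empty])
    (by rw [← halfSwap.preimage_closure, ← preimage_inter, hBA, preimage_empty])
    (fun z hz => hsub ⟨mem_image_of_mem _ hz.1, hz.2⟩)
    (fun z hz => htooth ⟨image_topBar ▸ mem_image_of_mem _
      ⟨Icc_subset_Icc_left zero_le_one hz.1.1, hz.1.2⟩, hz.2⟩)
  rintro _ ⟨⟨z, hz, rfl⟩, hzC⟩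
  exact hpre ⟨hz, hzC⟩

theorem union (h : CombLike Z) : CombLike (combOne ∪ halfSwap '' Z) where
  isCompact := isCompact_combOne.union (h.isCompact.image halfSwap.continuous)
  isPathConnected := isPathConnected_combOne.union
    (h.isPathConnected.image halfSwap.continuous) ⟨⟨1, 2⟩,
      spine_subset_combOne ⟨by norm_num, rfl⟩,
      mem_image_halfSwap.2 (h.spine_subset ⟨by norm_num, by norm_num⟩)⟩
  interior_eq := by
    rw [interior_union_isClosed_of_interior_empty isCompact_combOne.isClosed, interior_combOne]
    rw [← halfSwap.image_interior, h.interior_eq, image_empty]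
  subset_box := union_subset combOne_subset_box fun z hz => by
    have := image_halfSwap_box h.subset_box hz
    exact ⟨Icc_subset_Icc_right one_le_two this.1, this.2⟩
  combOne_subset := subset_union_left
  diff_subset A B C hC hAB hBA hsub hspine := by
    -- The side `A` spreads from the spine to the teeth, in particular to tooth 1, and from there to
    -- the image of `Z`.
    have h₁ : combOne \ C ⊆ A := combOne_diff_subset hC hAB hBA
      (fun z hz => hsub ⟨Or.inl hz.1, hz.2⟩) hspine
    have h₂ := h.image_diff_subset hC hAB hBA (fun z hz => hsub ⟨Or.inr hz.1, hz.2⟩)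
      fun z hz => h₁ ⟨tooth_subset_combOne one_mem_shiftedCantor hz.1, hz.2⟩
    rw [union_sdiff_distrib]
    exact union_subset h₁ h₂

end CombLike

theorem combLike_comb (k : ℕ) : CombLike (comb (k + 1)) := by
  induction k with
  | zero => exact combLike_combOne
  | succ k ih =>
    rw [comb_succ_succ]
    exact ih.union

/-! ## The comb `X_∞` -/

theorem comb_subset_combInfty (k : ℕ) : comb (k + 1) ⊆ combInfty := by
  have h : ∀ j, comb (j + 2) ⊆ combInfty := fun j z hz =>
    Or.inr (mem_iUnion₂.2 ⟨j + 2, by omega, hz⟩)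
  rcases k with _ | k
  · exact (combLike_comb 1).combOne_subset.trans (h 0)
  · exact h k

theorem mem_combInfty {z : ℂ} : z ∈ combInfty ↔ z = 0 ∨ ∃ k, z ∈ comb (k + 1) := by
  constructor
  · rintro (h | h)
    · exact Or.inl h
    · obtain ⟨k, hk, hz⟩ := mem_iUnion₂.1 h
      obtain ⟨j, rfl⟩ := Nat.exists_eq_add_of_le' (one_le_two.trans hk)
      exact Or.inr ⟨j, hz⟩
  · rintro (h | ⟨k, hz⟩)
    · exact Or.inl h
    · exact comb_subset_combInfty k hz

theorem zero_mem_combInfty : (0 : ℂ) ∈ combInfty := mem_combInfty.2 (Or.inl rfl)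

theorem halfSwap_zero : halfSwap 0 = 0 := by
  apply Complex.ext <;> simp [halfSwap_apply]

theorem combInfty_eq : combInfty = combOne ∪ halfSwap '' combInfty := by
  ext z
  constructor
  · intro hz
    rcases mem_combInfty.1 hz with rfl | ⟨_ | k, hz⟩
    · exact Or.inr ⟨0, zero_mem_combInfty, halfSwap_zero⟩
    · exact Or.inl hz
    · rw [comb_succ_succ] at hz
      exact hz.imp_right fun h => image_mono (comb_subset_combInfty k) h
  · rintro (hz | ⟨w, hw, rfl⟩)
    · exact comb_subset_combInfty 0 hz
    · rcases mem_combInfty.1 hw with rfl | ⟨k, hk⟩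
      · rw [halfSwap_zero]
        exact zero_mem_combInfty
      · refine comb_subset_combInfty (k + 1) ?_
        rw [comb_succ_succ]
        exact Or.inr (mem_image_of_mem _ hk)

theorem half_mem_combInfty {z : ℂ} (hz : z ∈ combInfty) : z / 2 ∈ combInfty := by
  rw [← halfSwap_halfSwap]
  have h : ∀ w ∈ combInfty, halfSwap w ∈ combInfty := fun w hw => by
    rw [combInfty_eq]
    exact Or.inr (mem_image_of_mem _ hw)
  exact h _ (h _ hz)

theorem combInfty_subset_box : combInfty ⊆ box := by
  intro z hz
  rcases mem_combInfty.1 hz with rfl | ⟨k, hk⟩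
  · exact ⟨by simp, by simp⟩
  · exact (combLike_comb k).subset_box hk

/-- Each unfolding of X_∞ = X₂ ∪ ½X_∞ adds two to the index of the finite stage and halves the
remainder near 0. The constant 4 bounds |x| + |y| on the box. -/
theorem combInfty_subset_union_closedBall (n : ℕ) :
    combInfty ⊆ comb (2 * n + 1) ∪ Metric.closedBall 0 (4 / 2 ^ n) := by
  induction n with
  | zero =>
    intro z hz
    obtain ⟨h₁, h₂⟩ := combInfty_subset_box hz
    refine Or.inr ?_
    rw [mem_closedBall_zero_iff]
    refine (Complex.norm_le_abs_re_add_abs_im z).trans ?_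
    rw [abs_of_nonneg h₁.1, abs_of_nonneg h₂.1]
    norm_num
    linarith [h₁.2, h₂.2]
  | succ n ih =>
    have hstep : comb (2 * (n + 1) + 1) =
        combOne ∪ (halfSwap '' combOne ∪ (fun z => z / 2) '' comb (2 * n + 1)) := by
      rw [show 2 * (n + 1) + 1 = 2 * n + 1 + 2 by ring, comb_succ_succ, comb_succ_succ, image_union,
        image_halfSwap_image_halfSwap]
    have hinfty : combInfty =
        combOne ∪ (halfSwap '' combOne ∪ (fun z => z / 2) '' combInfty) := by
      conv_lhs => rw [combInfty_eq, combInfty_eq, image_union, image_halfSwap_image_halfSwap]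
    intro z hz
    rw [hinfty] at hz
    rw [hstep]
    rcases hz with hz | hz | ⟨w, hw, rfl⟩
    · exact Or.inl (Or.inl hz)
    · exact Or.inl (Or.inr (Or.inl hz))
    · rcases ih hw with hw | hw
      · exact Or.inl (Or.inr (Or.inr ⟨w, hw, rfl⟩))
      · refine Or.inr ?_
        rw [mem_closedBall_zero_iff] at hw ⊢
        rw [norm_div, pow_succ, ← div_div]
        simpa using div_le_div_of_nonneg_right hw zero_le_two

theorem eq_zero_of_norm_le_pow {z : ℂ} (h : ∀ n : ℕ, ‖z‖ ≤ 4 / 2 ^ n) : z = 0 := by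
  by_contra hne
  obtain ⟨n, hn⟩ := exists_pow_lt_of_lt_one
    (show 0 < ‖z‖ / 4 from div_pos (norm_pos_iff.2 hne) (by norm_num))
    (by norm_num : (1 / 2 : ℝ) < 1)
  have := h n
  rw [one_div, inv_pow] at hn
  rw [div_eq_mul_inv] at this
  linarith

/-- X_∞ is the intersection of the finite stages, each enlarged by a ball about 0 with radius
tending to 0: a point outside every stage lies in all these balls, hence is 0. -/
theorem isClosed_combInfty : IsClosed combInfty := by
  have h : combInfty = ⋂ n : ℕ, (comb (2 * n + 1) ∪ Metric.closedBall 0 (4 / 2 ^ n)) := by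
    refine Subset.antisymm (subset_iInter combInfty_subset_union_closedBall) fun z hz => ?_
    rw [mem_combInfty]
    by_contra! hcon
    refine hcon.1 (eq_zero_of_norm_le_pow fun n => ?_)
    have := (mem_iInter.1 hz n).resolve_left (hcon.2 (2 * n))
    rwa [mem_closedBall_zero_iff] at this
  rw [h]
  exact isClosed_iInter fun n =>
    (combLike_comb (2 * n)).isCompact.isClosed.union Metric.isClosed_closedBall

theorem isCompact_combInfty : IsCompact combInfty :=
  (isCompact_reProdIm isCompact_Icc isCompact_Icc).of_isClosed_subset isClosed_combInfty
    combInfty_subset_box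

/-- Baire: X_∞ is a countable union of closed sets with empty interior. -/
theorem interior_combInfty : interior combInfty = ∅ := by
  rw [interior_eq_empty_iff_dense_compl]
  have h : combInftyᶜ = ({0} : Set ℂ)ᶜ ∩ ⋂ k : ℕ, (comb (k + 1))ᶜ := by
    ext z
    simp only [mem_compl_iff, mem_combInfty, mem_inter_iff, mem_singleton_iff, mem_iInter, not_or,
      not_exists]
  have hd : ∀ k : ℕ, Dense (comb (k + 1))ᶜ := fun k =>
    interior_eq_empty_iff_dense_compl.1 (combLike_comb k).interior_eq
  rw [h]
  exact (dense_compl_singleton 0).inter_of_isOpen_left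
    (dense_iInter_of_isOpen (fun k => (combLike_comb k).isCompact.isClosed.isOpen_compl) hd)
    isOpen_compl_singleton

theorem inv_two_pow_mem_comb (n : ℕ) : ((1 / 2 : ℂ)) ^ n ∈ comb (2 * n + 1) := by
  induction n with
  | zero => exact Or.inl ⟨by simpa using one_mem_shiftedCantor, by simp⟩
  | succ n ih =>
    rw [show 2 * (n + 1) + 1 = 2 * n + 1 + 2 by ring, comb_succ_succ, comb_succ_succ, image_union,
      image_halfSwap_image_halfSwap]
    exact Or.inr (Or.inr ⟨_, ih, by rw [pow_succ]; ring⟩)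

theorem combInfty_diff_subset (A B C : Set ℂ) (hC : C.Finite) (hAB : closure A ∩ B = ∅)
    (hBA : A ∩ closure B = ∅) (hsub : combInfty \ C ⊆ A ∪ B) (hspine : spine \ C ⊆ A) :
    combInfty \ C ⊆ A := by
  have hcomb : ∀ k, comb (k + 1) \ C ⊆ A := fun k => (combLike_comb k).diff_subset A B C hC hAB hBA
    (fun z hz => hsub ⟨comb_subset_combInfty k hz.1, hz.2⟩) hspine
  rintro z ⟨hz, hzC⟩
  rcases mem_combInfty.1 hz with rfl | ⟨k, hk⟩
  -- The point 0 is the limit of the points 2⁻ⁿ of the finite stages, which eventually avoid `C`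
  -- because `C` is closed and does not contain 0.
  · refine mem_left_of_mem_closure hAB (hsub ⟨hz, hzC⟩) ?_
    have hlim : Tendsto (fun n : ℕ => (1 / 2 : ℂ) ^ n) atTop (𝓝 0) :=
      tendsto_pow_atTop_nhds_zero_of_norm_lt_one (by norm_num)
    refine mem_closure_of_tendsto hlim ?_
    filter_upwards [hlim (hC.isClosed.isOpen_compl.mem_nhds hzC)] with n hn
    exact hcomb _ ⟨inv_two_pow_mem_comb n, hn⟩
  · exact hcomb k ⟨hk, hzC⟩

/-! ### The staircase -/

/-- The real part of the staircase, parametrised by the sum of the coordinates. -/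
noncomputable def stairRe (s : ℝ) : ℝ := ⨆ n : ℕ, min ((1 / 2) ^ n) (s - (1 / 2) ^ n)

theorem stairRe_term_le (s : ℝ) (n : ℕ) : min ((1 / 2 : ℝ) ^ n) (s - (1 / 2) ^ n) ≤ 1 :=
  (min_le_left _ _).trans (pow_le_one₀ (by norm_num) (by norm_num))

theorem bddAbove_stairRe (s : ℝ) :
    BddAbove (range fun n : ℕ => min ((1 / 2 : ℝ) ^ n) (s - (1 / 2) ^ n)) :=
  ⟨1, forall_mem_range.2 (stairRe_term_le s)⟩

/-- Every term is 1-Lipschitz, hence so is the supremum. Writing the staircase as a supremum thus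
gives continuity at 0, where infinitely many steps accumulate, with no gluing. -/
theorem stairRe_le_add (s t : ℝ) : stairRe s ≤ stairRe t + |s - t| := by
  refine ciSup_le fun n => ?_
  refine le_trans ?_ (add_le_add_left (le_ciSup (bddAbove_stairRe t) n) _)
  rw [← min_add_add_right]
  refine min_le_min ?_ ?_
  · linarith [abs_nonneg (s - t)]
  · linarith [le_abs_self (s - t)]

theorem continuous_stairRe : Continuous stairRe := by
  refine (LipschitzWith.of_dist_le_mul (K := 1) fun s t => ?_).continuous
  rw [Real.dist_eq, Real.dist_eq, NNReal.coe_one, one_mul, abs_le]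
  have h₁ := stairRe_le_add s t
  have h₂ := stairRe_le_add t s
  rw [abs_sub_comm] at h₂
  constructor <;> linarith

theorem stairRe_zero : stairRe 0 = 0 := by
  apply le_antisymm
  · refine ciSup_le fun n => (min_le_right _ _).trans ?_
    rw [zero_sub]
    exact neg_nonpos.2 (by positivity)
  -- At 0 the supremum is not attained: the terms are -2⁻ⁿ.
  · have hlim : Tendsto (fun n : ℕ => -((1 / 2 : ℝ) ^ n)) atTop (𝓝 0) := by
      simpa using (tendsto_pow_atTop_nhds_zero_of_lt_one (r := (1 / 2 : ℝ)) (by norm_num)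
        (by norm_num)).neg
    refine le_of_tendsto' hlim fun n => le_trans ?_ (le_ciSup (bddAbove_stairRe 0) n)
    refine le_min ?_ (by simp)
    have : (0 : ℝ) < (1 / 2) ^ n := by positivity
    linarith

/-- On this range the `n`-th term dominates: for m > n the bound 2⁻ᵐ is too small, for m < n the
bound s - 2⁻ᵐ is. The ranges cover (0, 3]. -/
theorem stairRe_eq {s : ℝ} {n : ℕ} (h₁ : 3 / 2 * (1 / 2) ^ n ≤ s) (h₂ : s ≤ 3 * (1 / 2) ^ n) :
    stairRe s = min ((1 / 2) ^ n) (s - (1 / 2) ^ n) := by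
  have hpos : (0 : ℝ) < (1 / 2) ^ n := by positivity
  refine le_antisymm (ciSup_le fun m => ?_) (le_ciSup (bddAbove_stairRe s) n)
  rcases lt_trichotomy m n with hm | rfl | hm
  · have : (1 / 2 : ℝ) ^ n ≤ (1 / 2) ^ m / 2 := by
      have := pow_le_pow_of_le_one (by norm_num : (0 : ℝ) ≤ 1 / 2) (by norm_num)
        (Nat.succ_le_of_lt hm)
      rw [Nat.succ_eq_add_one, pow_succ] at this
      linarith
    refine (min_le_right _ _).trans (le_min ?_ ?_) <;> linarith
  · exact le_rfl
  · have : (1 / 2 : ℝ) ^ m ≤ (1 / 2) ^ n / 2 := by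
      have := pow_le_pow_of_le_one (by norm_num : (0 : ℝ) ≤ 1 / 2) (by norm_num)
        (Nat.succ_le_of_lt hm)
      rw [Nat.succ_eq_add_one, pow_succ] at this
      linarith
    refine (min_le_left _ _).trans (le_min ?_ ?_) <;> linarith

/-- The largest step of the staircase, from (1, 2) to (1/2, 1). Its lower end is half its upper end,
so its halvings join up. -/
theorem corner_mem_combInfty {x y : ℝ} (h : x = 1 ∧ y ∈ Icc 1 2 ∨ x ∈ Icc (1 / 2) 1 ∧ y = 1) :
    (⟨x, y⟩ : ℂ) ∈ combInfty := by
  refine comb_subset_combInfty 1 ?_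
  rcases h with ⟨rfl, hy⟩ | ⟨hx, rfl⟩
  · exact Or.inl (tooth_subset_combOne one_mem_shiftedCantor
      ⟨rfl, Icc_subset_Icc_left zero_le_one hy⟩)
  · exact Or.inr ⟨⟨by linarith [hx.1], hx.2⟩, one_mem_shiftedCantor⟩

theorem inv_two_pow_smul_mem_combInfty {z : ℂ} (hz : z ∈ combInfty) (n : ℕ) :
    ((1 / 2 : ℝ) ^ n) • z ∈ combInfty := by
  induction n with
  | zero => simpa using hz
  | succ n ih =>
    convert half_mem_combInfty ih using 1
    rw [pow_succ, mul_comm, mul_smul, Complex.real_smul]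
    push_cast
    ring

theorem stair_mem_combInfty {s : ℝ} (h₀ : 0 ≤ s) (h₃ : s ≤ 3) :
    (⟨stairRe s, s - stairRe s⟩ : ℂ) ∈ combInfty := by
  rcases h₀.eq_or_lt with rfl | hpos
  · rw [stairRe_zero, sub_zero]
    exact zero_mem_combInfty
  -- Selects the step with 3/2 · 2⁻ⁿ < s ≤ 3 · 2⁻ⁿ; rescaling by 2ⁿ then reduces to the largest
  -- step.
  obtain ⟨n, hn₁, hn₂⟩ := exists_nat_pow_near_of_lt_one (x := s / 3) (y := 1 / 2)
    (by positivity) (by linarith) (by norm_num) (by norm_num)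
  rw [pow_succ] at hn₁
  rw [stairRe_eq (n := n) (by linarith) (by linarith)]
  have hp : (0 : ℝ) < (1 / 2) ^ n := by positivity
  set r : ℝ := (1 / 2) ^ n with hr
  have hsr : s = r * (s / r) := by field_simp
  have h₁ : 3 / 2 ≤ s / r := by rw [le_div_iff₀ hp]; linarith
  have h₂ : s / r ≤ 3 := by rw [div_le_iff₀ hp]; linarith
  have key : (⟨min r (s - r), s - min r (s - r)⟩ : ℂ) =
      r • (⟨min 1 (s / r - 1), s / r - min 1 (s / r - 1)⟩ : ℂ) := by
    have hmin : min r (s - r) = r * min 1 (s / r - 1) := by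
      rw [mul_min_of_nonneg _ _ hp.le, mul_one, mul_sub, mul_one, ← hsr]
    apply Complex.ext
    · simpa using hmin
    · simp only [Complex.smul_im, smul_eq_mul]
      rw [hmin, mul_sub, ← hsr]
  rw [key]
  refine inv_two_pow_smul_mem_combInfty (corner_mem_combInfty ?_) n
  rcases le_total (s / r) 2 with h | h
  · rw [min_eq_right (by linarith)]
    exact Or.inr ⟨⟨by linarith, by linarith⟩, by ring⟩
  · rw [min_eq_left (by linarith)]
    exact Or.inl ⟨rfl, by linarith, by linarith⟩

theorem joinedIn_combInfty_zero : JoinedIn combInfty 0 ⟨1, 2⟩ := by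
  have hf : Continuous fun t : ℝ => (⟨stairRe (3 * t), 3 * t - stairRe (3 * t)⟩ : ℂ) := by
    have : Continuous fun t : ℝ => stairRe (3 * t) :=
      continuous_stairRe.comp (continuous_const_mul 3)
    exact continuous_complex_mk this ((continuous_const_mul 3).sub this)
  refine JoinedIn.ofLine hf.continuousOn ?_ ?_ ?_
  · simp only [mul_zero, stairRe_zero, sub_zero]
    rfl
  · simp only [mul_one]
    rw [stairRe_eq (n := 0) (by norm_num) (by norm_num)]
    norm_num
  · rintro _ ⟨t, ht, rfl⟩
    exact stair_mem_combInfty (by linarith [ht.1]) (by linarith [ht.2])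

theorem isPathConnected_combInfty : IsPathConnected combInfty := by
  refine ⟨⟨1, 2⟩, joinedIn_combInfty_zero.mem.2, fun {z} hz => ?_⟩
  rcases mem_combInfty.1 hz with rfl | ⟨k, hk⟩
  · exact joinedIn_combInfty_zero.symm
  · exact ((combLike_comb k).isPathConnected.joinedIn _
      ((combLike_comb k).spine_subset ⟨by norm_num, rfl⟩) _ hk).mono (comb_subset_combInfty k)

theorem combLike_combInfty : CombLike combInfty where
  isCompact := isCompact_combInfty
  isPathConnected := isPathConnected_combInfty
  interior_eq := interior_combInfty
  subset_box := combInfty_subset_box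
  combOne_subset := comb_subset_combInfty 0
  diff_subset := combInfty_diff_subset

/-! ## Fibers of the combs -/

/-- The function whose level sets are the fibers of the combs. -/
def cutRe (z : ℂ) : ℝ := max z.re 1

theorem continuous_cutRe : Continuous cutRe := Complex.continuous_re.max continuous_const

theorem cutRe_of_le {z : ℂ} (h : z.re ≤ 1) : cutRe z = 1 := max_eq_right h

theorem cutRe_of_lt {z : ℂ} (h : 1 < z.re) : cutRe z = z.re := max_eq_left h.le

theorem combOne_column_of_notMem {z : ℂ} (hz : z ∈ combOne) (h : z.re ∉ shiftedCantor) :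
    {w ∈ combOne | w.re = z.re} = {z} := by
  ext w
  constructor
  · rintro ⟨hw, hre⟩
    exact Complex.ext hre (by rw [combOne_im_eq hz h, combOne_im_eq hw (hre ▸ h)])
  · rintro rfl
    exact ⟨hz, rfl⟩

/-- `Y` extends Cantor's comb to the left, and its left part is connected and cannot be separated
by finite sets. -/
structure LeftCombed (Y : Set ℂ) : Prop extends CombLike Y where
  mem_combOne : ∀ z ∈ Y, 1 < z.re → z ∈ combOne
  isPreconnected_leftPart : IsPreconnected (leftPart Y)
  not_separatedBy : ∀ C : Set ℂ, C.Finite → ∀ z ∈ leftPart Y, ∀ w ∈ leftPart Y,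
    ¬ SeparatedBy Y C z w

namespace LeftCombed

variable {Y : Set ℂ}

theorem slice_of_le {z : ℂ} (h : z.re ≤ 1) : {w ∈ Y | cutRe w = cutRe z} = leftPart Y := by
  ext w
  rw [cutRe_of_le h]
  exact and_congr_right fun _ => max_eq_right_iff

theorem slice_of_lt (hY : LeftCombed Y) {z : ℂ} (h : 1 < z.re) :
    {w ∈ Y | cutRe w = cutRe z} = {w ∈ combOne | w.re = z.re} := by
  ext w
  rw [cutRe_of_lt h]
  constructor
  · rintro ⟨hw, hre⟩
    have hlt : 1 < w.re := by
      by_contra hle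
      rw [cutRe_of_le (not_lt.1 hle)] at hre
      linarith
    rw [cutRe_of_lt hlt] at hre
    exact ⟨hY.mem_combOne w hw hlt, hre⟩
  · rintro ⟨hw, hre⟩
    refine ⟨hY.combOne_subset hw, ?_⟩
    rw [cutRe_of_lt (hre ▸ h), hre]

theorem slice_of_mem (hY : LeftCombed Y) {z : ℂ} (h : 1 < z.re) (hK : z.re ∈ shiftedCantor) :
    {w ∈ Y | cutRe w = cutRe z} = tooth z.re := by
  rw [hY.slice_of_lt h, combOne_column hK]

theorem slice_of_notMem (hY : LeftCombed Y) {z : ℂ} (hz : z ∈ Y) (h : 1 < z.re)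
    (hK : z.re ∉ shiftedCantor) : {w ∈ Y | cutRe w = cutRe z} = {z} := by
  rw [hY.slice_of_lt h, combOne_column_of_notMem (hY.mem_combOne z hz h) hK]

theorem tooth_subset_leftPart (hY : LeftCombed Y) : tooth 1 ⊆ leftPart Y :=
  fun _ hz => ⟨hY.tooth_subset one_mem_shiftedCantor hz, hz.1.le⟩

theorem leftPart_ne_singleton (hY : LeftCombed Y) (z : ℂ) : leftPart Y ≠ {z} := by
  intro h
  have hsub := hY.tooth_subset_leftPart
  rw [h] at hsub
  refine tooth_ne_singleton 1 z (hsub.antisymm ?_)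
  rintro _ rfl
  have h₀ : (⟨1, 0⟩ : ℂ) ∈ tooth 1 := ⟨rfl, by norm_num⟩
  have := hsub h₀
  rw [mem_singleton_iff] at this
  rwa [← this]

end LeftCombed

/-- A separation by a finite set does not divide a tooth of a comb. -/
theorem CombLike.not_separatedBy_tooth {Y C : Set ℂ} (hY : CombLike Y) (hC : C.Finite) {t : ℝ}
    (ht : t ∈ shiftedCantor) {z w : ℂ} (hz : z ∈ tooth t) (hw : w ∈ tooth t) :
    ¬ SeparatedBy Y C z w := by
  rintro ⟨A, B, h, hAB, hBA, hzA, hwB⟩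
  rw [hY.isCompact.isClosed.frontier_eq, hY.interior_eq, sdiff_empty] at h
  exact not_mem_tooth_of_separation hC hAB hBA
    (fun u hu x hx => h.subset ⟨hY.tooth_subset hu hx.1, hx.2⟩) ht hz hw hzA hwB

/-- The finite levels are of two kinds: those below 1 are empty because `cutRe` is at least 1, and
those above 1 off the Cantor set are single points of the spine. -/
theorem LeftCombed.sliceFibers {Y : Set ℂ} (hY : LeftCombed Y) : SliceFibers Y cutRe where
  isContinuum := hY.isContinuum
  interior_eq := hY.interior_eq
  continuous := continuous_cutRe
  exists_finite a b hab := by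
    rcases le_or_gt b 1 with hb | hb
    · refine ⟨(a + b) / 2, ⟨by linarith, by linarith⟩, ?_⟩
      convert finite_empty (α := ℂ)
      refine eq_empty_of_forall_notMem ?_
      rintro w ⟨-, hw⟩
      have : 1 ≤ cutRe w := le_max_right _ _
      linarith
    · obtain ⟨s, ⟨hs₁, hs₂⟩, hs⟩ := exists_notMem_shiftedCantor (max_lt hab hb)
      have h₁ : 1 < s := (le_max_right a 1).trans_lt hs₁
      refine ⟨s, ⟨(le_max_left a 1).trans_lt hs₁, hs₂⟩,
        (finite_singleton (⟨s, 2⟩ : ℂ)).subset ?_⟩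
      rintro w ⟨hw, hre⟩
      have hlt : 1 < w.re := by
        by_contra hle
        rw [cutRe_of_le (not_lt.1 hle)] at hre
        linarith
      rw [cutRe_of_lt hlt] at hre
      exact Complex.ext hre (combOne_im_eq (hY.mem_combOne w hw hlt) (hre ▸ hs))
  isPreconnected z hz := by
    rcases le_or_gt z.re 1 with h | h
    · rw [LeftCombed.slice_of_le h]
      exact hY.isPreconnected_leftPart
    · by_cases hK : z.re ∈ shiftedCantor
      · rw [hY.slice_of_mem h hK]
        exact isPreconnected_tooth _
      · rw [hY.slice_of_notMem hz h hK]
        exact isPreconnected_singleton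
  not_separatedBy C hC z hz w hw hzw := by
    have hw' : w ∈ {w ∈ Y | cutRe w = cutRe z} := ⟨hw, hzw.symm⟩
    rcases le_or_gt z.re 1 with h | h
    · rw [LeftCombed.slice_of_le h] at hw'
      exact hY.not_separatedBy C hC z ⟨hz, h⟩ w hw'
    · by_cases hK : z.re ∈ shiftedCantor
      · rw [hY.slice_of_mem h hK] at hw'
        exact hY.toCombLike.not_separatedBy_tooth hC hK
          ⟨rfl, combOne_im_mem (hY.mem_combOne z hz h)⟩ hw'
      · rw [hY.slice_of_notMem hz h hK] at hw'
        rw [mem_singleton_iff.1 hw']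
        exact not_separatedBy_self Y C z

namespace LeftCombed

variable {Y : Set ℂ}

theorem fiber_of_le (hY : LeftCombed Y) {z : ℂ} (hz : z ∈ Y) (h : z.re ≤ 1) :
    fiber Y z = leftPart Y := by
  rw [hY.sliceFibers.fiber_eq hz, slice_of_le h]

theorem fiber_of_mem (hY : LeftCombed Y) {z : ℂ} (hz : z ∈ Y) (h : 1 < z.re)
    (hK : z.re ∈ shiftedCantor) : fiber Y z = tooth z.re := by
  rw [hY.sliceFibers.fiber_eq hz, hY.slice_of_mem h hK]

theorem fiber_of_notMem (hY : LeftCombed Y) {z : ℂ} (hz : z ∈ Y) (h : 1 < z.re)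
    (hK : z.re ∉ shiftedCantor) : fiber Y z = {z} := by
  rw [hY.sliceFibers.fiber_eq hz, hY.slice_of_notMem hz h hK]

theorem image_cutRe (hY : LeftCombed Y) : cutRe '' Y = Icc 1 2 := by
  apply Subset.antisymm
  · rintro _ ⟨z, hz, rfl⟩
    exact ⟨le_max_right _ _, max_le (hY.subset_box hz).1.2 one_le_two⟩
  · intro t ht
    exact ⟨⟨t, 2⟩, hY.spine_subset ⟨ht, rfl⟩, max_eq_left ht.1⟩

theorem nonempty_fiberQuotient_homeomorph (hY : LeftCombed Y) :
    Nonempty (FiberQuotient Y ≃ₜ unitInterval) := by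
  refine hY.sliceFibers.nonempty_fiberQuotient_homeomorph isCompact_shiftedCantor.isClosed
    isTotallyDisconnected_shiftedCantor (fun z hz => ?_) one_lt_two hY.image_cutRe
  rcases le_or_gt z.re 1 with h | h
  · rw [slice_of_le h, cutRe_of_le h]
    exact iff_of_false (hY.leftPart_ne_singleton z) (not_not.2 one_mem_shiftedCantor)
  · by_cases hK : z.re ∈ shiftedCantor
    · rw [hY.slice_of_mem h hK, cutRe_of_lt h]
      exact iff_of_false (tooth_ne_singleton _ z) (not_not.2 hK)
    · rw [hY.slice_of_notMem hz h hK, cutRe_of_lt h]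
      exact iff_of_true rfl hK

end LeftCombed

theorem leftCombed_combOne : LeftCombed combOne where
  toCombLike := combLike_combOne
  mem_combOne _ hz _ := hz
  isPreconnected_leftPart := leftPart_combOne ▸ isPreconnected_tooth 1
  not_separatedBy C hC z hz w hw := by
    rw [leftPart_combOne] at hz hw
    exact combLike_combOne.not_separatedBy_tooth hC one_mem_shiftedCantor hz hw

theorem CombLike.isPathConnected_union_topBar {Z : Set ℂ} (h : CombLike Z) :
    IsPathConnected (Z ∪ topBar) := by
  have h₂ : (⟨2, 2⟩ : ℂ) ∈ topBar := ⟨by norm_num, rfl⟩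
  exact h.isPathConnected.union (convex_topBar.isPathConnected ⟨_, h₂⟩)
    ⟨_, h.spine_subset ⟨by norm_num, rfl⟩, h₂⟩

theorem CombLike.leftPart_diff_subset {Z A B C : Set ℂ} (h : CombLike Z) (hC : C.Finite)
    (hAB : closure A ∩ B = ∅) (hBA : A ∩ closure B = ∅)
    (hsub : (combOne ∪ halfSwap '' Z) \ C ⊆ A ∪ B) (htooth : tooth 1 \ C ⊆ A) :
    leftPart (combOne ∪ halfSwap '' Z) \ C ⊆ A := by
  rw [leftPart_union h.subset_box, image_union, image_topBar, union_sdiff_distrib]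
  exact union_subset (h.image_diff_subset hC hAB hBA
    (fun z hz => hsub ⟨Or.inr hz.1, hz.2⟩) htooth) htooth

/-- Up to the finite set, tooth 1 lies in one part of any separation, and that part then contains
the rest of the left side. The case split decides which part it is; the second case is the first
with `A` and `B` exchanged. -/
theorem CombLike.leftCombed {Z : Set ℂ} (h : CombLike Z) :
    LeftCombed (combOne ∪ halfSwap '' Z) where
  toCombLike := h.union
  mem_combOne z hz hlt :=
    hz.resolve_right fun h' => absurd (image_halfSwap_box h.subset_box h').1.2 (not_le.2 hlt)
  isPreconnected_leftPart := by
    rw [leftPart_union h.subset_box]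
    exact h.isPathConnected_union_topBar.isConnected.isPreconnected.image _
      halfSwap.continuous.continuousOn
  not_separatedBy C hC z hz w hw := by
    rintro ⟨A, B, hY, hAB, hBA, hzA, hwB⟩
    rw [h.union.isCompact.isClosed.frontier_eq, h.union.interior_eq, sdiff_empty] at hY
    have hteeth : ∀ t ∈ shiftedCantor, tooth t \ C ⊆ A ∪ B := fun u hu x hx =>
      hY.subset ⟨h.union.tooth_subset hu hx.1, hx.2⟩
    have hzC : z ∉ C := (hY.superset (Or.inl hzA)).2
    have hwC : w ∉ C := (hY.superset (Or.inr hwB)).2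
    by_cases hA : ∃ p ∈ tooth 1, p ∈ A
    · obtain ⟨p, hp, hpA⟩ := hA
      have htooth : tooth 1 \ C ⊆ A := fun q hq =>
        (hteeth 1 one_mem_shiftedCantor hq).resolve_right fun hqB =>
          not_mem_tooth_of_separation hC hAB hBA hteeth one_mem_shiftedCantor hp hq.1 hpA hqB
      have hwA := h.leftPart_diff_subset hC hAB hBA hY.subset htooth ⟨hw, hwC⟩
      exact eq_empty_iff_forall_notMem.1 hAB w ⟨subset_closure hwA, hwB⟩
    · have htooth : tooth 1 \ C ⊆ B := fun q hq =>
        (hteeth 1 one_mem_shiftedCantor hq).resolve_left fun hqA => hA ⟨q, hq.1, hqA⟩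
      have hzB := h.leftPart_diff_subset hC (inter_comm A _ ▸ hBA) (inter_comm _ B ▸ hAB)
        (union_comm A B ▸ hY.subset) htooth ⟨hz, hzC⟩
      exact eq_empty_iff_forall_notMem.1 hBA z ⟨hzA, subset_closure hzB⟩

/-! ## Scales -/

/-- The height function has one-point levels, so all fibers of a segment are points and chains stop
after one step. -/
theorem sliceFibers_tooth (t : ℝ) : SliceFibers (tooth t) Complex.im where
  isContinuum := ⟨isCompact_tooth t, ⟨⟨t, 0⟩, rfl, by norm_num⟩, isPreconnected_tooth t⟩
  interior_eq := by
    change interior ({t} ×ℂ Icc 0 2) = ∅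
    rw [Complex.interior_reProdIm, interior_singleton]
    ext z
    simp [Complex.mem_reProdIm]
  continuous := Complex.continuous_im
  exists_finite a b hab := ⟨(a + b) / 2, ⟨by linarith, by linarith⟩,
    (finite_singleton (⟨t, (a + b) / 2⟩ : ℂ)).subset fun w hw => Complex.ext hw.1.1 hw.2⟩
  isPreconnected z hz := by
    refine Subsingleton.isPreconnected ?_
    rintro u ⟨hu, hu'⟩ v ⟨hv, hv'⟩
    exact Complex.ext (hu.1.trans hv.1.symm) (hu'.trans hv'.symm)
  not_separatedBy C _ z hz w hw hzw := by
    rw [Complex.ext (hw.1.trans hz.1.symm) hzw.symm]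
    exact not_separatedBy_self _ C z

theorem hasFiberChain_tooth {t : ℝ} {z : ℂ} (hz : z ∈ tooth t) : HasFiberChain (tooth t) z 1 := by
  rw [(sliceFibers_tooth t).hasFiberChain_succ hz 0, hasFiberChain_zero,
    (sliceFibers_tooth t).fiber_eq hz]
  ext w
  exact ⟨fun h => Complex.ext (h.1.1.trans hz.1.symm) h.2, fun h => by
    rw [mem_singleton_iff.1 h]
    exact ⟨hz, rfl⟩⟩

theorem nlcScale_tooth (t : ℝ) : nlcScale (tooth t) = 0 :=
  nonpos_iff_eq_zero.1 (nlcScale_le (n := 0) fun _ hx => ⟨1, le_rfl, hasFiberChain_tooth hx⟩)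

theorem nlcScale_singleton (z : ℂ) : nlcScale {z} = 0 :=
  nonpos_iff_eq_zero.1 (nlcScale_le (n := 0) fun _ hx =>
    ⟨0, zero_le_one, hasFiberChain_zero.2 (by rw [mem_singleton_iff.1 hx])⟩)

/-- A continuum whose fibers are points or vertical segments, not all of them points, has
scale one. -/
theorem SliceFibers.hasScale_one {X : Set ℂ} {g : ℂ → ℝ} (h : SliceFibers X g)
    (hfib : ∀ x ∈ X, fiber X x = {x} ∨ ∃ t, fiber X x = tooth t)
    (hne : ∃ x ∈ X, fiber X x ≠ {x}) : HasScale X 1 := by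
  refine ⟨fun x hx => ?_, ?_⟩
  · rcases hfib x hx with hx' | ⟨t, ht⟩
    · refine ⟨1, by norm_num, ?_⟩
      rwa [h.hasFiberChain_succ hx, hasFiberChain_zero]
    · refine ⟨2, le_rfl, ?_⟩
      rw [h.hasFiberChain_succ hx, ht]
      exact hasFiberChain_tooth (ht ▸ h.mem_fiber hx)
  · obtain ⟨x, hx, hx'⟩ := hne
    refine ⟨x, hx, fun k hk hc => ?_⟩
    -- Length 0 would make `X` a point, and length 1 would make the fiber at `x` a point.
    interval_cases k
    · rw [hasFiberChain_zero] at hc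
      have hsub := h.fiber_subset hx
      rw [hc] at hsub hx'
      refine hx' (hsub.antisymm ?_)
      have := h.mem_fiber hx
      rw [hc] at this
      exact singleton_subset_iff.2 this
    · rw [h.hasFiberChain_succ hx, hasFiberChain_zero] at hc
      exact hx' hc

theorem hasScale_combOne : HasScale combOne 1 := by
  have h := leftCombed_combOne
  refine h.sliceFibers.hasScale_one (fun x hx => ?_) ⟨⟨1, 2⟩, ?_, ?_⟩
  · rcases le_or_gt x.re 1 with hx' | hx'
    · rw [h.fiber_of_le hx hx', leftPart_combOne]
      exact Or.inr ⟨1, rfl⟩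
    · by_cases hK : x.re ∈ shiftedCantor
      · exact Or.inr ⟨_, h.fiber_of_mem hx hx' hK⟩
      · exact Or.inl (h.fiber_of_notMem hx hx' hK)
  · exact spine_subset_combOne ⟨by norm_num, rfl⟩
  · rw [h.fiber_of_le (spine_subset_combOne ⟨by norm_num, rfl⟩) le_rfl]
    exact h.leftPart_ne_singleton _

/-! ### Cantor's comb with a handle -/

theorem handle_column_of_notMem {z : ℂ} (hz : z ∈ combOne ∪ topBar) (h : z.re ∉ shiftedCantor) :
    {w ∈ combOne ∪ topBar | w.re = z.re} = {z} := by
  have him : ∀ w ∈ combOne ∪ topBar, w.re ∉ shiftedCantor → w.im = 2 := fun w hw hK =>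
    hw.elim (fun h' => combOne_im_eq h' hK) fun h' => h'.2
  ext w
  constructor
  · rintro ⟨hw, hre⟩
    exact Complex.ext hre (by rw [him z hz h, him w hw (hre ▸ h)])
  · rintro rfl
    exact ⟨hz, rfl⟩

theorem handle_column {t : ℝ} (ht : t ∈ shiftedCantor) :
    {w ∈ combOne ∪ topBar | w.re = t} = tooth t := by
  ext w
  exact ⟨fun h => ⟨h.2, (union_subset combOne_subset_box topBar_subset_box h.1).2⟩,
    fun h => ⟨Or.inl (tooth_subset_combOne ht h), h.1⟩⟩

theorem interior_handle : interior (combOne ∪ topBar) = ∅ := by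
  rw [interior_union_isClosed_of_interior_empty isCompact_combOne.isClosed interior_topBar,
    interior_combOne]

/-- This set is needed because the left part of X₂ is its image under `halfSwap`, not that of X₁.
The handle has one-point fibers, so the level function is the real part itself and not `cutRe`. -/
theorem sliceFibers_handle : SliceFibers (combOne ∪ topBar) Complex.re where
  isContinuum := ⟨isCompact_combOne.union isCompact_topBar,
    combLike_combOne.isPathConnected_union_topBar.isConnected⟩
  interior_eq := interior_handle
  continuous := Complex.continuous_re
  exists_finite a b hab := by
    obtain ⟨s, hs, hK⟩ := exists_notMem_shiftedCantor hab
    refine ⟨s, hs, (finite_singleton (⟨s, 2⟩ : ℂ)).subset ?_⟩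
    rintro w ⟨hw | hw, rfl⟩
    · exact Complex.ext rfl (combOne_im_eq hw hK)
    · exact Complex.ext rfl hw.2
  isPreconnected z hz := by
    by_cases hK : z.re ∈ shiftedCantor
    · rw [handle_column hK]
      exact isPreconnected_tooth _
    · rw [handle_column_of_notMem hz hK]
      exact isPreconnected_singleton
  not_separatedBy C hC z hz w hw hzw := by
    by_cases hK : z.re ∈ shiftedCantor
    · rintro ⟨A, B, h, hAB, hBA, hzA, hwB⟩
      rw [(isCompact_combOne.union isCompact_topBar).isClosed.frontier_eq, interior_handle,
        sdiff_empty] at h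
      refine not_mem_tooth_of_separation hC hAB hBA (fun u hu x hx =>
        h.subset ⟨Or.inl (tooth_subset_combOne hu hx.1), hx.2⟩) hK (p := z) (q := w)
        ?_ ?_ hzA hwB
      · exact (handle_column hK).subset ⟨hz, rfl⟩
      · exact (handle_column hK).subset ⟨hw, hzw.symm⟩
    · have hw' : w ∈ ({z} : Set ℂ) := (handle_column_of_notMem hz hK).subset ⟨hw, hzw.symm⟩
      rw [mem_singleton_iff.1 hw']
      exact not_separatedBy_self _ C z

theorem hasScale_handle : HasScale (combOne ∪ topBar) 1 := by
  refine sliceFibers_handle.hasScale_one (fun x hx => ?_) ⟨⟨1, 2⟩, ?_, ?_⟩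
  · rw [sliceFibers_handle.fiber_eq hx]
    by_cases hK : x.re ∈ shiftedCantor
    · exact Or.inr ⟨_, handle_column hK⟩
    · exact Or.inl (handle_column_of_notMem hx hK)
  · exact Or.inr ⟨by norm_num, rfl⟩
  · rw [sliceFibers_handle.fiber_eq (Or.inr ⟨by norm_num, rfl⟩),
      handle_column one_mem_shiftedCantor]
    exact tooth_ne_singleton _ _

/-! ### The recursion for the scale -/

/-- Passing to the left part costs one link, so chains at left points are exactly one longer than
those in `Z ∪ topBar`. Points to the right need at most two links and do not affect the maximum. -/
theorem CombLike.hasScale_succ {Z : Set ℂ} (h : CombLike Z) {n : ℕ} (hn : 1 ≤ n)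
    (hZ : HasScale (Z ∪ topBar) n) : HasScale (combOne ∪ halfSwap '' Z) (n + 1) := by
  have hY := h.leftCombed
  have hleft : ∀ x ∈ Z ∪ topBar, ∀ k, HasFiberChain (combOne ∪ halfSwap '' Z) (halfSwap x) (k + 1) ↔
      HasFiberChain (Z ∪ topBar) x k := by
    intro x hx k
    have hmem : halfSwap x ∈ leftPart (combOne ∪ halfSwap '' Z) := by
      rw [leftPart_union h.subset_box]
      exact mem_image_of_mem _ hx
    rw [hY.sliceFibers.hasFiberChain_succ hmem.1, hY.fiber_of_le hmem.1 hmem.2,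
      leftPart_union h.subset_box, hasFiberChain_image]
  refine ⟨fun x hx => ?_, ?_⟩
  · rcases le_or_gt x.re 1 with hx' | hx'
    · have hmem : x ∈ leftPart (combOne ∪ halfSwap '' Z) := ⟨hx, hx'⟩
      rw [leftPart_union h.subset_box] at hmem
      obtain ⟨y, hy, rfl⟩ := hmem
      obtain ⟨k, hk, hc⟩ := hZ.1 y hy
      exact ⟨k + 1, by omega, (hleft y hy k).2 hc⟩
    · by_cases hK : x.re ∈ shiftedCantor
      · refine ⟨2, by omega, ?_⟩
        rw [hY.sliceFibers.hasFiberChain_succ hx, hY.fiber_of_mem hx hx' hK]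
        exact hasFiberChain_tooth ⟨rfl, (hY.subset_box hx).2⟩
      · refine ⟨1, by omega, ?_⟩
        rw [hY.sliceFibers.hasFiberChain_succ hx, hasFiberChain_zero,
          hY.fiber_of_notMem hx hx' hK]
  · obtain ⟨x, hx, hc⟩ := hZ.2
    have hmem : halfSwap x ∈ leftPart (combOne ∪ halfSwap '' Z) := by
      rw [leftPart_union h.subset_box]
      exact mem_image_of_mem _ hx
    refine ⟨halfSwap x, hmem.1, ?_⟩
    -- A chain of length 0 is impossible since the set contains a tooth; a longer one descends to a
    -- forbidden chain in `Z ∪ topBar`.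
    rintro (_ | k) hk hchain
    · rw [hasFiberChain_zero] at hchain
      have hsub : tooth 1 ⊆ {halfSwap x} :=
        hchain ▸ hY.tooth_subset one_mem_shiftedCantor
      exact tooth_ne_singleton 1 _ (hsub.antisymm (singleton_subset_iff.2
        (by
          have h₀ : (⟨1, 0⟩ : ℂ) ∈ tooth 1 := ⟨rfl, by norm_num⟩
          rwa [← mem_singleton_iff.1 (hsub h₀)])))
    · exact hc k (by omega) ((hleft x hx k).1 hchain)

/-- The left half of the bar is the horizontal tooth at height 2 ∈ K + 1. Hence adjoining the bar
changes X₁ but no later comb. -/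
theorem topBar_subset_combTwo : topBar ⊆ combTwo := by
  rintro z ⟨hz, him⟩
  rcases le_total z.re 1 with h | h
  · exact Or.inr ⟨⟨hz.1, h⟩, him ▸ two_mem_shiftedCantor⟩
  · exact Or.inl (spine_subset_combOne ⟨⟨h, hz.2⟩, him⟩)

theorem topBar_subset_comb (k : ℕ) : topBar ⊆ comb (k + 2) := by
  refine topBar_subset_combTwo.trans ?_
  rw [comb_succ_succ, combTwo_eq]
  exact union_subset_union_right _ (image_mono (combLike_comb k).combOne_subset)

theorem hasScale_comb (k : ℕ) : HasScale (comb (k + 1)) (k + 1) := by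
  induction k with
  | zero => exact hasScale_combOne
  | succ k ih =>
    rw [comb_succ_succ]
    refine (combLike_comb k).hasScale_succ (by omega) ?_
    -- Only the passage from X₁ to X₂ meets a genuine handle.
    rcases k with _ | k
    · exact hasScale_handle
    · rwa [union_eq_self_of_subset_right (topBar_subset_comb k)]

theorem leftPart_comb (k : ℕ) : leftPart (comb (k + 3)) = halfSwap '' comb (k + 2) := by
  rw [comb_succ_succ, leftPart_union (combLike_comb (k + 1)).subset_box,
    union_eq_self_of_subset_right (topBar_subset_comb k)]

theorem leftPart_combInfty : leftPart combInfty = halfSwap '' combInfty := by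
  conv_lhs => rw [combInfty_eq]
  rw [leftPart_union combInfty_subset_box, union_eq_self_of_subset_right
    ((topBar_subset_comb 0).trans (comb_subset_combInfty 1))]

theorem leftCombed_combInfty : LeftCombed combInfty := by
  rw [combInfty_eq]
  exact combLike_combInfty.leftCombed

theorem leftCombed_comb (k : ℕ) : LeftCombed (comb (k + 1)) := by
  rcases k with _ | k
  · exact leftCombed_combOne
  · rw [comb_succ_succ]
    exact (combLike_comb k).leftCombed

/-- Descent: the fiber at 0 is the image of X_∞ itself under `halfSwap`, which fixes 0, so a chain
reaching 0 could always be shortened by one link. -/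
theorem not_hasFiberChain_combInfty (k : ℕ) : ¬ HasFiberChain combInfty 0 k := by
  induction k with
  | zero =>
    rw [hasFiberChain_zero]
    intro h
    have h₂ : (⟨1, 2⟩ : ℂ) ∈ combInfty := combLike_combInfty.spine_subset ⟨by norm_num, rfl⟩
    rw [h, mem_singleton_iff] at h₂
    exact one_ne_zero (congrArg Complex.re h₂)
  | succ k ih =>
    rw [leftCombed_combInfty.sliceFibers.hasFiberChain_succ zero_mem_combInfty,
      leftCombed_combInfty.fiber_of_le zero_mem_combInfty (by simp), leftPart_combInfty]
    intro h
    rw [← halfSwap_zero, hasFiberChain_image] at h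
    exact ih h

theorem nlcScale_combInfty : nlcScale combInfty = ⊤ := by
  refine eq_top_iff.2 ?_
  rw [← localScale_eq_top not_hasFiberChain_combInfty]
  exact le_iSup₂ (f := fun x (_ : x ∈ combInfty) => localScale combInfty x) 0 zero_mem_combInfty

theorem nlcScale_leftPart_comb_pos (k : ℕ) : 0 < nlcScale (leftPart (comb (k + 2))) := by
  rw [comb_succ_succ, leftPart_union (combLike_comb k).subset_box, nlcScale_image]
  rcases k with _ | k
  · change 0 < nlcScale (combOne ∪ topBar)
    rw [hasScale_handle.nlcScale_eq]
    norm_num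
  · rw [union_eq_self_of_subset_right (topBar_subset_comb k), (hasScale_comb (k + 1)).nlcScale_eq]
    exact_mod_cast Nat.succ_pos _

/-! ## Cantor's comb -/

/-- The affine map `(x, y) ↦ (x - 1, y / 2)`. -/
noncomputable def combShift : ℂ ≃ₜ ℂ where
  toFun z := ⟨z.re - 1, z.im / 2⟩
  invFun z := ⟨z.re + 1, 2 * z.im⟩
  left_inv z := by apply Complex.ext <;> simp; ring
  right_inv z := by apply Complex.ext <;> simp
  continuous_toFun := Complex.equivRealProdCLM.symm.continuous.comp
    ((Complex.continuous_re.sub continuous_const).prodMk (Complex.continuous_im.div_const 2))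
  continuous_invFun := Complex.equivRealProdCLM.symm.continuous.comp
    ((Complex.continuous_re.add continuous_const).prodMk (Complex.continuous_im.const_mul 2))

theorem mem_combOne_iff_combShift (z : ℂ) : z ∈ combOne ↔ combShift z ∈ cantorComb := by
  change (z.re ∈ shiftedCantor ∧ z.im ∈ Icc 0 2) ∨ (z.re ∈ Icc 1 2 ∧ z.im = 2) ↔
    (z.re - 1 ∈ cantorSet ∧ z.im / 2 ∈ Icc 0 1) ∨ (z.re - 1 ∈ Icc 0 1 ∧ z.im / 2 = 1)
  rw [mem_shiftedCantor]
  simp only [mem_Icc]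
  refine or_congr (and_congr_right fun _ => ?_) (and_congr ?_ ?_)
  · constructor <;> rintro ⟨h₁, h₂⟩ <;> constructor <;> linarith
  · constructor <;> rintro ⟨h₁, h₂⟩ <;> constructor <;> linarith
  · constructor <;> intro h <;> linarith

/-! ## The fibers of the larger combs -/

/-- Fibers to the right of 1 are segments or points, of scale 0, so positivity of the scale of the
left part gives the strict inequality. -/
theorem LeftCombed.fiber_description {Y : Set ℂ} (hY : LeftCombed Y)
    (hpos : 0 < nlcScale (leftPart Y)) :
    (1 + 2 * Complex.I ∈ Y ∧ fiber Y (1 + 2 * Complex.I) = leftPart Y) ∧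
      ∀ z ∈ Y, (z.re ≤ 1 → fiber Y z = leftPart Y) ∧
        (1 < z.re → z.re ∈ shiftedCantor →
          fiber Y z = {w | w.re = z.re ∧ w.im ∈ Icc 0 2}) ∧
        (1 < z.re → z.re ∉ shiftedCantor → fiber Y z = {z}) ∧
        (1 < z.re → nlcScale (fiber Y z) < nlcScale (leftPart Y)) := by
  have hmem : 1 + 2 * Complex.I ∈ Y := hY.spine_subset ⟨by simp, by simp⟩
  refine ⟨⟨hmem, hY.fiber_of_le hmem (by simp)⟩, fun z hz => ⟨hY.fiber_of_le hz,
    hY.fiber_of_mem hz, hY.fiber_of_notMem hz, fun h => ?_⟩⟩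
  by_cases hK : z.re ∈ shiftedCantor
  · rwa [hY.fiber_of_mem hz h hK, nlcScale_tooth]
  · rwa [hY.fiber_of_notMem hz h hK, nlcScale_singleton]

theorem fiber_combOne {z : ℂ} (hz : z ∈ combOne) :
    (z.re ∈ shiftedCantor → fiber combOne z = {w | w.re = z.re ∧ w.im ∈ Icc 0 2}) ∧
      (z.re ∉ shiftedCantor → fiber combOne z = {z}) := by
  have h := leftCombed_combOne
  rcases le_or_gt z.re 1 with hz' | hz'
  · have h₁ : z.re = 1 := le_antisymm hz' (combOne_re_mem hz).1
    rw [h₁]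
    refine ⟨fun _ => ?_, fun hK => absurd one_mem_shiftedCantor hK⟩
    rw [h.fiber_of_le hz hz', leftPart_combOne]
    rfl
  · exact ⟨h.fiber_of_mem hz hz', h.fiber_of_notMem hz hz'⟩

end CombFiber

theorem mainTheorem7 :
    -- the continua `X_k`, `k ≥ 1`
    (∀ k : ℕ, 1 ≤ k →
      CombFiber.IsContinuum (CombFiber.comb k) ∧ IsPathConnected (CombFiber.comb k) ∧
      CombFiber.nlcScale (CombFiber.comb k) = (k : ℕ∞) ∧
      Nonempty (CombFiber.FiberQuotient (CombFiber.comb k) ≃ₜ unitInterval)) ∧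
    -- the continuum `X_∞`
    (CombFiber.IsContinuum CombFiber.combInfty ∧ IsPathConnected CombFiber.combInfty ∧
      CombFiber.nlcScale CombFiber.combInfty = ⊤ ∧
      Nonempty (CombFiber.FiberQuotient CombFiber.combInfty ≃ₜ unitInterval)) ∧
    -- `X_1` is a copy of Cantor's comb; its fibers
    Nonempty (CombFiber.comb 1 ≃ₜ CombFiber.cantorComb) ∧
    (∀ z ∈ CombFiber.comb 1,
      (z.re ∈ CombFiber.shiftedCantor →
        CombFiber.fiber (CombFiber.comb 1) z = {w | w.re = z.re ∧ w.im ∈ Set.Icc 0 2}) ∧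
      (z.re ∉ CombFiber.shiftedCantor → CombFiber.fiber (CombFiber.comb 1) z = {z})) ∧
    -- the fibers of `X_k`, `k ≥ 2`, and of `X_∞`; the largest fiber has the largest scale
    (∀ Y : Set ℂ, (Y = CombFiber.combInfty ∨ ∃ k : ℕ, 2 ≤ k ∧ Y = CombFiber.comb k) →
      (1 + 2 * Complex.I ∈ Y ∧
        CombFiber.fiber Y (1 + 2 * Complex.I) = CombFiber.leftPart Y) ∧
      (∀ z ∈ Y,
        (z.re ≤ 1 → CombFiber.fiber Y z = CombFiber.leftPart Y) ∧
        (1 < z.re → z.re ∈ CombFiber.shiftedCantor →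
          CombFiber.fiber Y z = {w | w.re = z.re ∧ w.im ∈ Set.Icc 0 2}) ∧
        (1 < z.re → z.re ∉ CombFiber.shiftedCantor → CombFiber.fiber Y z = {z}) ∧
        (1 < z.re →
          CombFiber.nlcScale (CombFiber.fiber Y z) <
            CombFiber.nlcScale (CombFiber.leftPart Y)))) ∧
    -- the largest fibers up to homeomorphism
    (∀ k : ℕ, 1 ≤ k →
      Nonempty (CombFiber.leftPart (CombFiber.comb (k + 2)) ≃ₜ CombFiber.comb (k + 1))) ∧
    Nonempty (CombFiber.leftPart CombFiber.combInfty ≃ₜ CombFiber.combInfty) := by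
  refine ⟨fun k hk => ?_, ⟨CombFiber.combLike_combInfty.isContinuum,
    CombFiber.isPathConnected_combInfty, CombFiber.nlcScale_combInfty,
    CombFiber.leftCombed_combInfty.nonempty_fiberQuotient_homeomorph⟩,
    ⟨CombFiber.combShift.subtype CombFiber.mem_combOne_iff_combShift⟩,
    fun z hz => CombFiber.fiber_combOne hz, ?_, fun k hk => ?_, ?_⟩
  · obtain ⟨k, rfl⟩ := Nat.exists_eq_add_of_le' hk
    exact ⟨(CombFiber.combLike_comb k).isContinuum, (CombFiber.combLike_comb k).isPathConnected,
      (CombFiber.hasScale_comb k).nlcScale_eq,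
      (CombFiber.leftCombed_comb k).nonempty_fiberQuotient_homeomorph⟩
  · rintro Y (rfl | ⟨k, hk, rfl⟩)
    · refine CombFiber.leftCombed_combInfty.fiber_description ?_
      rw [CombFiber.leftPart_combInfty, CombFiber.nlcScale_image, CombFiber.nlcScale_combInfty]
      exact ENat.top_pos
    · obtain ⟨k, rfl⟩ := Nat.exists_eq_add_of_le' hk
      exact (CombFiber.leftCombed_comb (k + 1)).fiber_description
        (CombFiber.nlcScale_leftPart_comb_pos k)
  · obtain ⟨k, rfl⟩ := Nat.exists_eq_add_of_le' hk
    rw [CombFiber.leftPart_comb]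
    exact ⟨(CombFiber.halfSwap.image _).symm⟩
  · rw [CombFiber.leftPart_combInfty]
    exact ⟨(CombFiber.halfSwap.image _).symm⟩
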